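/- Let $(\mathcal M,g)$ be a four-dimensional smooth Lorentzian manifold of signature $(+,+,+,-)$ that satisfies the vacuum Einstein equations with cosmological constant $\Lambda\in\mathbb R$, $$R_{\mu\nu}-\tfrac12 R\,g_{\mu\nu}+\Lambda g_{\mu\nu}=0 .$$ Let $\Sigma$ be a three-dimensional spatial hypersurface smoothly immersed in $\mathcal M$ (the induced metric $\gamma$ is Riemannian), with a smooth unit normal $n$, $g(n,n)=-1$. Let $D$ be the Levi-Civita connection and $\overset{3}{R}{}_{ij}$ the Ricci tensor of $\gamma$, let $K_{ij}=-g(\partial_i,\nabla_{\partial_j}n)$ be the extrinsic curvature, with $\nabla$ the Levi-Civita connection of $g$, and let $K=K^i{}_i$. The curvature conventions are $(\nabla_\alpha\nabla_\beta-\nabla_\beta\nabla_\alpha)v^\gamma=R^\gamma{}_{\mu\alpha\beta}v^\mu$ and $R_{\mu\nu}=R^\alpha{}_{\mu\alpha\nu}$, and square brackets on indices denote antisymmetrization with the factor $\frac12$. The Weyl tensor is $$W_{\alpha\beta\mu\nu}=R_{\alpha\beta\mu\nu}-\bigl(g_{\alpha[\mu}R_{\nu]\beta}-g_{\beta[\mu}R_{\nu]\alpha}\bigr)+\tfrac13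 R\,g_{\alpha[\mu}g_{\nu]\beta},$$ and its electric and magnetic parts along $\Sigma$ are $$E_{\alpha\beta}=W_{\alpha\mu\nu\beta}n^\mu n^\nu,\qquad B_{\alpha\beta}=\tfrac12\,W_{\alpha\mu\lambda\sigma}\,\varepsilon^{\lambda\sigma}{}_{\nu\beta}\,n^\mu n^\nu ,$$ with components $E_{ij}$, $B_{ij}$ along the coordinate vectors $\partial_1,\partial_2,\partial_3$ of $\Sigma$. In coordinates $(y^1,\dots,y^4)$ of $\mathcal M$ and $(x^1,x^2,x^3)$ of $\Sigma$ the antisymmetric tensors are normalized by $\sqrt{|\det g|}\,\varepsilon^{1234}=1$ and $\sqrt{\det\gamma}\,\varepsilon^{123}=1$. Then, at every point of $\Sigma$ and for all such coordinates around it, $$E_{ij}=-\overset{3}{R}{}_{ij}-K\,K_{ij}+K_{ik}K^k{}_j+\tfrac23\Lambda\,\gamma_{ij},$$ and, if the coordinates are compatibly oriented, i.e. the frame $(\partial_1,\partial_2,\partial_3,n)$ is positively oriented with respect to $(y^1,\dots,y^4)$, $$B_{ij}=\varepsilon^{ls}{}_j\,D_sK_{il}.$$ -/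

import Mathlib

open scoped Manifold ContDiff Matrix

attribute [-instance] TopCat.of.chartedSpace

noncomputable section

namespace ADM

/-! ### Tensor calculus in a coordinate domain of `ℝⁿ`

A tensor field is given by its components, functions of the coordinates. -/

/-- The partial derivative `∂_i f`. -/
def pd {n : ℕ} (i : Fin n) (f : EuclideanSpace ℝ (Fin n) → ℝ) (x : EuclideanSpace ℝ (Fin n)) : ℝ :=
  fderiv ℝ f x (EuclideanSpace.single i 1)

/-- Christoffel symbols `Γ^k_{ij}` of a metric with components `h`. -/
def christoffel {n : ℕ} (h : EuclideanSpace ℝ (Fin n) → Matrix (Fin n) (Fin n) ℝ)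
    (k i j : Fin n) (x : EuclideanSpace ℝ (Fin n)) : ℝ :=
  (1 / 2) * ∑ l, (h x)⁻¹ k l *
    (pd i (fun y => h y l j) x + pd j (fun y => h y l i) x - pd l (fun y => h y i j) x)

/-- The Riemann tensor `R^a_{bcd}`, with `(∇_c ∇_d - ∇_d ∇_c) v^a = R^a_{bcd} v^b`. -/
def riemannUp {n : ℕ} (h : EuclideanSpace ℝ (Fin n) → Matrix (Fin n) (Fin n) ℝ)
    (a b c d : Fin n) (x : EuclideanSpace ℝ (Fin n)) : ℝ :=
  pd c (christoffel h a d b) x - pd d (christoffel h a c b) x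
    + ∑ m, (christoffel h a c m x * christoffel h m d b x
      - christoffel h a d m x * christoffel h m c b x)

/-- The Riemann tensor `R_{abcd}` with all indices down. -/
def riemann {n : ℕ} (h : EuclideanSpace ℝ (Fin n) → Matrix (Fin n) (Fin n) ℝ)
    (a b c d : Fin n) (x : EuclideanSpace ℝ (Fin n)) : ℝ :=
  ∑ m, h x a m * riemannUp h m b c d x

/-- The Ricci tensor `R_{ij} = R^a_{iaj}`. -/
def ricci {n : ℕ} (h : EuclideanSpace ℝ (Fin n) → Matrix (Fin n) (Fin n) ℝ)
    (i j : Fin n) (x : EuclideanSpace ℝ (Fin n)) : ℝ :=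
  ∑ a, riemannUp h a i a j x

/-- The scalar curvature `R = h^{ij} R_{ij}`. -/
def scalarCurvature {n : ℕ} (h : EuclideanSpace ℝ (Fin n) → Matrix (Fin n) (Fin n) ℝ)
    (x : EuclideanSpace ℝ (Fin n)) : ℝ :=
  ∑ i, ∑ j, (h x)⁻¹ i j * ricci h i j x

/-- The covariant derivative `D_s T_{ij}` of a covariant two-tensor. -/
def covDeriv {n : ℕ} (h T : EuclideanSpace ℝ (Fin n) → Matrix (Fin n) (Fin n) ℝ)
    (s i j : Fin n) (x : EuclideanSpace ℝ (Fin n)) : ℝ :=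
  pd s (fun y => T y i j) x - ∑ m, christoffel h m s i x * T x m j
    - ∑ m, christoffel h m s j x * T x i m

/-- The Levi-Civita symbol: the sign of `f` if `f` is a permutation, and `0` otherwise. -/
def leviCivitaSymbol {n : ℕ} (f : Fin n → Fin n) : ℝ :=
  Matrix.det (Matrix.of fun i j => if f i = j then (1 : ℝ) else 0)

/-- The contravariant antisymmetric tensor, normalized by `√|det h| ε^{1 2 … n} = 1`. -/
def epsilonUp {n : ℕ} (h : EuclideanSpace ℝ (Fin n) → Matrix (Fin n) (Fin n) ℝ)
    (f : Fin n → Fin n) (x : EuclideanSpace ℝ (Fin n)) : ℝ :=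
  leviCivitaSymbol f / √|(h x).det|

/-- `ε^{λσ}_{νβ}` in dimension four. -/
def epsilonMixed4 (h : EuclideanSpace ℝ (Fin 4) → Matrix (Fin 4) (Fin 4) ℝ)
    (l s v b : Fin 4) (x : EuclideanSpace ℝ (Fin 4)) : ℝ :=
  ∑ r, ∑ t, epsilonUp h ![l, s, r, t] x * h x r v * h x t b

/-- `ε^{ls}_j` in dimension three. -/
def epsilonMixed3 (h : EuclideanSpace ℝ (Fin 3) → Matrix (Fin 3) (Fin 3) ℝ)
    (l s j : Fin 3) (x : EuclideanSpace ℝ (Fin 3)) : ℝ :=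
  ∑ m, epsilonUp h ![l, s, m] x * h x m j

/-- The Weyl tensor in dimension four,
`W_{αβμν} = R_{αβμν} - (h_{α[μ} R_{ν]β} - h_{β[μ} R_{ν]α}) + (1/3) R h_{α[μ} h_{ν]β}`. -/
def weyl (h : EuclideanSpace ℝ (Fin 4) → Matrix (Fin 4) (Fin 4) ℝ)
    (a b m v : Fin 4) (x : EuclideanSpace ℝ (Fin 4)) : ℝ :=
  riemann h a b m v x
    - ((1 / 2) * (h x a m * ricci h v b x - h x a v * ricci h m b x)
      - (1 / 2) * (h x b m * ricci h v a x - h x b v * ricci h m a x))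
    + (1 / 3) * scalarCurvature h x * ((1 / 2) * (h x a m * h x v b - h x a v * h x m b))

/-- The right dual of the Weyl tensor, `W*_{αβμν} = (1/2) W_{αβλδ} ε^{λδ}_{μν}`. -/
def weylDual (h : EuclideanSpace ℝ (Fin 4) → Matrix (Fin 4) (Fin 4) ℝ)
    (a b m v : Fin 4) (x : EuclideanSpace ℝ (Fin 4)) : ℝ :=
  (1 / 2) * ∑ l, ∑ d, weyl h a b l d x * epsilonMixed4 h l d m v x

/-! ### Components on manifolds -/

/-- The coordinate vector `∂_i` of the chart `e`, at the point with coordinates `y`. -/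
def coordVec {n : ℕ} {M : Type*} [TopologicalSpace M] [ChartedSpace (EuclideanSpace ℝ (Fin n)) M]
    (e : OpenPartialHomeomorph M (EuclideanSpace ℝ (Fin n))) (y : EuclideanSpace ℝ (Fin n))
    (i : Fin n) : TangentSpace (𝓡 n) (e.symm y) :=
  mfderiv (𝓡 n) (𝓡 n) e.symm y
    (EuclideanSpace.single i (1 : ℝ) : EuclideanSpace ℝ (Fin n))

/-- The component `v^μ` of a tangent vector `v` at `x`, in the chart `e`. -/
def vecComp {n : ℕ} {M : Type*} [TopologicalSpace M] [ChartedSpace (EuclideanSpace ℝ (Fin n)) M]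
    (e : OpenPartialHomeomorph M (EuclideanSpace ℝ (Fin n))) {x : M} (v : TangentSpace (𝓡 n) x)
    (μ : Fin n) : ℝ :=
  (EuclideanSpace.proj μ : EuclideanSpace ℝ (Fin n) →L[ℝ] ℝ) (mfderiv (𝓡 n) (𝓡 n) e x v)

/-- A smooth Lorentzian metric of signature `(+,+,+,-)` on a four-dimensional manifold. -/
structure LorentzianMetric (M : Type*) [TopologicalSpace M]
    [ChartedSpace (EuclideanSpace ℝ (Fin 4)) M] [IsManifold (𝓡 4) ∞ M] where
  /-- the scalar product on each tangent space -/
  val (x : M) : TangentSpace (𝓡 4) x →L[ℝ] TangentSpace (𝓡 4) x →L[ℝ] ℝ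
  symm (x : M) (v w : TangentSpace (𝓡 4) x) : val x v w = val x w v
  signature (x : M) : ∃ b : Module.Basis (Fin 4) ℝ (TangentSpace (𝓡 4) x), ∀ i j,
    val x (b i) (b j) = if i = j then (if i = 3 then -1 else 1) else 0
  contMDiff : ContMDiff (𝓡 4)
    ((𝓡 4).prod 𝓘(ℝ, EuclideanSpace ℝ (Fin 4) →L[ℝ] EuclideanSpace ℝ (Fin 4) →L[ℝ] ℝ)) ∞
    (fun x => Bundle.TotalSpace.mk'
      (EuclideanSpace ℝ (Fin 4) →L[ℝ] EuclideanSpace ℝ (Fin 4) →L[ℝ] ℝ)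
      (E := fun x : M => TangentSpace (𝓡 4) x →L[ℝ] TangentSpace (𝓡 4) x →L[ℝ] ℝ) x (val x))

namespace LorentzianMetric

variable {M : Type*} [TopologicalSpace M] [ChartedSpace (EuclideanSpace ℝ (Fin 4)) M]
  [IsManifold (𝓡 4) ∞ M]

/-- The components `g_{μν}` in the chart `e`, as functions of the coordinates. -/
def comp (g : LorentzianMetric M) (e : OpenPartialHomeomorph M (EuclideanSpace ℝ (Fin 4)))
    (y : EuclideanSpace ℝ (Fin 4)) : Matrix (Fin 4) (Fin 4) ℝ :=
  Matrix.of fun μ ν => g.val (e.symm y) (coordVec e y μ) (coordVec e y ν)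

/-- The vacuum Einstein equations with cosmological constant,
`R_{μν} - (1/2) R g_{μν} + Λ g_{μν} = 0`, in every chart of the smooth structure. -/
def IsVacuum (g : LorentzianMetric M) (Λ : ℝ) : Prop :=
  ∀ e ∈ IsManifold.maximalAtlas (𝓡 4) ∞ M, ∀ y ∈ e.target, ∀ μ ν : Fin 4,
    ricci (g.comp e) μ ν y - (1 / 2) * scalarCurvature (g.comp e) y * g.comp e y μ ν
      + Λ * g.comp e y μ ν = 0

end LorentzianMetric

/-- A three-dimensional spatial hypersurface, immersed in the spacetime `(M, g)`: a smooth map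
`S → M` that pulls `g` back to a Riemannian metric, with a smooth timelike unit normal. -/
structure SpatialHypersurface {M : Type*} [TopologicalSpace M]
    [ChartedSpace (EuclideanSpace ℝ (Fin 4)) M] [IsManifold (𝓡 4) ∞ M] (g : LorentzianMetric M)
    (S : Type*) [TopologicalSpace S] [ChartedSpace (EuclideanSpace ℝ (Fin 3)) S]
    [IsManifold (𝓡 3) ∞ S] where
  /-- the immersion -/
  toFun : S → M
  contMDiff_toFun : ContMDiff (𝓡 3) (𝓡 4) ∞ toFun
  spacelike (p : S) (v : TangentSpace (𝓡 3) p) : v ≠ 0 →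
    0 < g.val (toFun p) (mfderiv (𝓡 3) (𝓡 4) toFun p v) (mfderiv (𝓡 3) (𝓡 4) toFun p v)
  /-- the unit normal -/
  normal (p : S) : TangentSpace (𝓡 4) (toFun p)
  normal_unit (p : S) : g.val (toFun p) (normal p) (normal p) = -1
  normal_orthogonal (p : S) (v : TangentSpace (𝓡 3) p) :
    g.val (toFun p) (normal p) (mfderiv (𝓡 3) (𝓡 4) toFun p v) = 0
  contMDiff_normal : ContMDiff (𝓡 3) (𝓡 4).tangent ∞
    (fun p => (⟨toFun p, normal p⟩ : TangentBundle (𝓡 4) M))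

namespace SpatialHypersurface

variable {M : Type*} [TopologicalSpace M] [ChartedSpace (EuclideanSpace ℝ (Fin 4)) M]
  [IsManifold (𝓡 4) ∞ M] {g : LorentzianMetric M}
  {S : Type*} [TopologicalSpace S] [ChartedSpace (EuclideanSpace ℝ (Fin 3)) S]
  [IsManifold (𝓡 3) ∞ S]

/-- The components `γ_{ij}` of the induced metric in the chart `c` of the hypersurface. -/
def gamma (H : SpatialHypersurface g S) (c : OpenPartialHomeomorph S (EuclideanSpace ℝ (Fin 3)))
    (x : EuclideanSpace ℝ (Fin 3)) : Matrix (Fin 3) (Fin 3) ℝ :=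
  Matrix.of fun i j => g.val (H.toFun (c.symm x))
    (mfderiv (𝓡 3) (𝓡 4) H.toFun (c.symm x) (coordVec c x i))
    (mfderiv (𝓡 3) (𝓡 4) H.toFun (c.symm x) (coordVec c x j))

/-- The immersion in the coordinates given by a chart `e` of `M` and a chart `c` of `S`. -/
def coordMap (H : SpatialHypersurface g S)
    (e : OpenPartialHomeomorph M (EuclideanSpace ℝ (Fin 4)))
    (c : OpenPartialHomeomorph S (EuclideanSpace ℝ (Fin 3)))
    (x : EuclideanSpace ℝ (Fin 3)) : EuclideanSpace ℝ (Fin 4) :=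
  e (H.toFun (c.symm x))

/-- The components `∂_i x^μ` of the vectors that span the tangent space of the hypersurface. -/
def tangentComp (H : SpatialHypersurface g S)
    (e : OpenPartialHomeomorph M (EuclideanSpace ℝ (Fin 4)))
    (c : OpenPartialHomeomorph S (EuclideanSpace ℝ (Fin 3)))
    (i : Fin 3) (μ : Fin 4) (x : EuclideanSpace ℝ (Fin 3)) : ℝ :=
  pd i (fun z => H.coordMap e c z μ) x

/-- The components `n^μ` of the unit normal in the chart `e`, as functions of the coordinates on
the hypersurface. -/
def normalComp (H : SpatialHypersurface g S)
    (e : OpenPartialHomeomorph M (EuclideanSpace ℝ (Fin 4)))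
    (c : OpenPartialHomeomorph S (EuclideanSpace ℝ (Fin 3)))
    (μ : Fin 4) (x : EuclideanSpace ℝ (Fin 3)) : ℝ :=
  vecComp e (H.normal (c.symm x)) μ

/-- The component `(∇_i n)^ν` of the derivative of the unit normal along the hypersurface, for the
Levi-Civita connection of `g`. -/
def covDerivNormal (H : SpatialHypersurface g S)
    (e : OpenPartialHomeomorph M (EuclideanSpace ℝ (Fin 4)))
    (c : OpenPartialHomeomorph S (EuclideanSpace ℝ (Fin 3)))
    (i : Fin 3) (ν : Fin 4) (x : EuclideanSpace ℝ (Fin 3)) : ℝ :=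
  pd i (H.normalComp e c ν) x + ∑ α, ∑ β, christoffel (g.comp e) ν α β (H.coordMap e c x) *
    H.tangentComp e c i α x * H.normalComp e c β x

/-- The extrinsic curvature, `K_{ij} = - g(∂_i, ∇_j n)`. -/
def extrinsic (H : SpatialHypersurface g S)
    (e : OpenPartialHomeomorph M (EuclideanSpace ℝ (Fin 4)))
    (c : OpenPartialHomeomorph S (EuclideanSpace ℝ (Fin 3)))
    (x : EuclideanSpace ℝ (Fin 3)) : Matrix (Fin 3) (Fin 3) ℝ :=
  Matrix.of fun i j => - ∑ μ, ∑ ν, g.comp e (H.coordMap e c x) μ ν *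
    H.tangentComp e c i μ x * H.covDerivNormal e c j ν x

/-- The trace `K = γ^{ij} K_{ij}`. -/
def meanCurvature (H : SpatialHypersurface g S)
    (e : OpenPartialHomeomorph M (EuclideanSpace ℝ (Fin 4)))
    (c : OpenPartialHomeomorph S (EuclideanSpace ℝ (Fin 3)))
    (x : EuclideanSpace ℝ (Fin 3)) : ℝ :=
  ∑ i, ∑ j, (H.gamma c x)⁻¹ i j * H.extrinsic e c x i j

/-- The electric part `E_{αβ} = W_{αμνβ} n^μ n^ν` of the Weyl tensor. -/
def electric4 (H : SpatialHypersurface g S)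
    (e : OpenPartialHomeomorph M (EuclideanSpace ℝ (Fin 4)))
    (c : OpenPartialHomeomorph S (EuclideanSpace ℝ (Fin 3)))
    (α β : Fin 4) (x : EuclideanSpace ℝ (Fin 3)) : ℝ :=
  ∑ μ, ∑ ν, weyl (g.comp e) α μ ν β (H.coordMap e c x) *
    H.normalComp e c μ x * H.normalComp e c ν x

/-- The magnetic part `B_{αβ} = W*_{αμνβ} n^μ n^ν` of the Weyl tensor. -/
def magnetic4 (H : SpatialHypersurface g S)
    (e : OpenPartialHomeomorph M (EuclideanSpace ℝ (Fin 4)))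
    (c : OpenPartialHomeomorph S (EuclideanSpace ℝ (Fin 3)))
    (α β : Fin 4) (x : EuclideanSpace ℝ (Fin 3)) : ℝ :=
  ∑ μ, ∑ ν, weylDual (g.comp e) α μ ν β (H.coordMap e c x) *
    H.normalComp e c μ x * H.normalComp e c ν x

/-- The spatial components `E_{ij}`. -/
def electric (H : SpatialHypersurface g S)
    (e : OpenPartialHomeomorph M (EuclideanSpace ℝ (Fin 4)))
    (c : OpenPartialHomeomorph S (EuclideanSpace ℝ (Fin 3)))
    (i j : Fin 3) (x : EuclideanSpace ℝ (Fin 3)) : ℝ :=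
  ∑ α, ∑ β, H.electric4 e c α β x * H.tangentComp e c i α x * H.tangentComp e c j β x

/-- The spatial components `B_{ij}`. -/
def magnetic (H : SpatialHypersurface g S)
    (e : OpenPartialHomeomorph M (EuclideanSpace ℝ (Fin 4)))
    (c : OpenPartialHomeomorph S (EuclideanSpace ℝ (Fin 3)))
    (i j : Fin 3) (x : EuclideanSpace ℝ (Fin 3)) : ℝ :=
  ∑ α, ∑ β, H.magnetic4 e c α β x * H.tangentComp e c i α x * H.tangentComp e c j β x

/-- The matrix in the chart `e` of the frame `(∂_1, ∂_2, ∂_3, n)` along the hypersurface. -/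
def frame (H : SpatialHypersurface g S)
    (e : OpenPartialHomeomorph M (EuclideanSpace ℝ (Fin 4)))
    (c : OpenPartialHomeomorph S (EuclideanSpace ℝ (Fin 3)))
    (x : EuclideanSpace ℝ (Fin 3)) : Matrix (Fin 4) (Fin 4) ℝ :=
  Matrix.of ![fun μ => H.tangentComp e c 0 μ x, fun μ => H.tangentComp e c 1 μ x,
    fun μ => H.tangentComp e c 2 μ x, fun μ => H.normalComp e c μ x]

/-- The charts `c` of the hypersurface and `e` of the spacetime are compatibly oriented at `x`:
the frame `(∂_1, ∂_2, ∂_3, n)` is positively oriented in `e`. -/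
def CompatiblyOriented (H : SpatialHypersurface g S)
    (e : OpenPartialHomeomorph M (EuclideanSpace ℝ (Fin 4)))
    (c : OpenPartialHomeomorph S (EuclideanSpace ℝ (Fin 3)))
    (x : EuclideanSpace ℝ (Fin 3)) : Prop :=
  0 < (H.frame e c x).det

end SpatialHypersurface

end ADM

end

/-!
The claim is local, and everything in it is expressed in coordinates: the immersion becomes a smooth
map `φ` from an open set of `ℝ³` to an open set of `ℝ⁴` that carries a metric `h`, with a unit normal
field `N` along it (`SpatialHypersurface.isParamHypersurface`).

Vector fields along `φ` have a covariant derivative `∇_i` (`covAlong`). It is compatible with the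
metric (`IsSmoothMap.pd_ip`) and torsion-free (`IsSmoothMap.covAlong_velocity_comm`), and its
commutator is the curvature of `h` (`IsSmoothMap.covAlong_comm`). Hence the Gauss formula
`∇_i ∂_j = Γ^m_{ij} ∂_m - K_{ij} N`, and by differentiating once more the equations of Gauss and
Codazzi (`IsParamHypersurface.gauss_equation`, `IsParamHypersurface.codazzi_equation`).

The vacuum equations force `R_{μν} = Λ g_{μν}`, so that the Weyl tensor is the curvature tensor minus
`Λ / 3` times the curvature tensor of constant curvature one (`IsMetricOn.weyl_of_vacuum`).

For the electric part, `R(∂_i, n, n, ∂_j)` is found by computing the Ricci tensor as a trace in the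
frame `(∂_1, ∂_2, ∂_3, n)`: what remains is the trace of the Gauss equation
(`IsParamHypersurface.electric_eq`). For the magnetic part, contracting the four-dimensional `ε` with
the normal leaves the three-dimensional one (`IsAdaptedFrame.epsilonMixed4_contract`), which only
sees the components `R(∂_i, n, ∂_p, ∂_q)`; these are given by the Codazzi equation
(`IsParamHypersurface.magnetic_eq`).
-/

noncomputable section

namespace ADM

/-! ### Partial derivatives -/

section PartialDerivatives

variable {m n : ℕ}

theorem pd_add {i : Fin n} {f g : EuclideanSpace ℝ (Fin n) → ℝ} {x : EuclideanSpace ℝ (Fin n)}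
    (hf : DifferentiableAt ℝ f x) (hg : DifferentiableAt ℝ g x) :
    pd i (fun y => f y + g y) x = pd i f x + pd i g x := by
  simp [pd, fderiv_fun_add hf hg]

theorem pd_sub {i : Fin n} {f g : EuclideanSpace ℝ (Fin n) → ℝ} {x : EuclideanSpace ℝ (Fin n)}
    (hf : DifferentiableAt ℝ f x) (hg : DifferentiableAt ℝ g x) :
    pd i (fun y => f y - g y) x = pd i f x - pd i g x := by
  simp [pd, fderiv_fun_sub hf hg]

theorem pd_mul {i : Fin n} {f g : EuclideanSpace ℝ (Fin n) → ℝ} {x : EuclideanSpace ℝ (Fin n)}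
    (hf : DifferentiableAt ℝ f x) (hg : DifferentiableAt ℝ g x) :
    pd i (fun y => f y * g y) x = pd i f x * g x + f x * pd i g x := by
  simp [pd, fderiv_fun_mul hf hg]
  ring

theorem pd_sum {ι : Type*} {s : Finset ι} {i : Fin n} {f : ι → EuclideanSpace ℝ (Fin n) → ℝ}
    {x : EuclideanSpace ℝ (Fin n)} (hf : ∀ k ∈ s, DifferentiableAt ℝ (f k) x) :
    pd i (fun y => ∑ k ∈ s, f k y) x = ∑ k ∈ s, pd i (f k) x := by
  simp [pd, fderiv_fun_sum hf]

@[simp]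
theorem pd_const (i : Fin n) (a : ℝ) (x : EuclideanSpace ℝ (Fin n)) :
    pd i (fun _ => a) x = 0 := by
  simp [pd]

theorem pd_coord (i j : Fin n) (x : EuclideanSpace ℝ (Fin n)) :
    pd i (fun y : EuclideanSpace ℝ (Fin n) => y j) x = if i = j then 1 else 0 := by
  have : (fun y : EuclideanSpace ℝ (Fin n) => y j)
      = (EuclideanSpace.proj j : EuclideanSpace ℝ (Fin n) →L[ℝ] ℝ) := rfl
  rw [pd, this, ContinuousLinearMap.fderiv]
  simp [eq_comm]

theorem pd_congr {U : Set (EuclideanSpace ℝ (Fin n))} (hU : IsOpen U) {i : Fin n}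
    {f g : EuclideanSpace ℝ (Fin n) → ℝ} (h : ∀ y ∈ U, f y = g y)
    {x : EuclideanSpace ℝ (Fin n)} (hx : x ∈ U) : pd i f x = pd i g x := by
  have : f =ᶠ[nhds x] g := Filter.eventuallyEq_of_mem (hU.mem_nhds hx) h
  simp [pd, this.fderiv_eq]

theorem sum_smul_single (v : EuclideanSpace ℝ (Fin n)) :
    ∑ α, v α • EuclideanSpace.single α (1 : ℝ) = v := by
  ext j
  simp [Pi.single_apply]

theorem pd_apply_eq_fderiv {i : Fin m} {φ : EuclideanSpace ℝ (Fin m) → EuclideanSpace ℝ (Fin n)}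
    {x : EuclideanSpace ℝ (Fin m)} (hφ : DifferentiableAt ℝ φ x) (α : Fin n) :
    pd i (fun y => φ y α) x = (fderiv ℝ φ x (EuclideanSpace.single i 1)) α := by
  have h1 := ((EuclideanSpace.proj α : EuclideanSpace ℝ (Fin n) →L[ℝ] ℝ).hasFDerivAt.comp x
    hφ.hasFDerivAt).fderiv
  have h2 : (fun y => φ y α) = (EuclideanSpace.proj α : EuclideanSpace ℝ (Fin n) →L[ℝ] ℝ) ∘ φ :=
    rfl
  rw [pd, h2, h1]
  rfl

/-- The chain rule for partial derivatives. -/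
theorem pd_comp {i : Fin m} {f : EuclideanSpace ℝ (Fin n) → ℝ}
    {φ : EuclideanSpace ℝ (Fin m) → EuclideanSpace ℝ (Fin n)} {x : EuclideanSpace ℝ (Fin m)}
    (hf : DifferentiableAt ℝ f (φ x)) (hφ : DifferentiableAt ℝ φ x) :
    pd i (fun y => f (φ y)) x = ∑ α, pd α f (φ x) * pd i (fun y => φ y α) x := by
  have h3 : pd i (fun y => f (φ y)) x
      = fderiv ℝ f (φ x) (fderiv ℝ φ x (EuclideanSpace.single i 1)) := by
    have := (hf.hasFDerivAt.comp x hφ.hasFDerivAt).fderiv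
    have h2 : (fun y => f (φ y)) = f ∘ φ := rfl
    rw [pd, h2, this]
    rfl
  rw [h3, ← sum_smul_single (fderiv ℝ φ x (EuclideanSpace.single i 1)), map_sum]
  refine Finset.sum_congr rfl fun α _ => ?_
  rw [map_smul, pd_apply_eq_fderiv hφ, smul_eq_mul, mul_comm]
  rfl

theorem contDiffOn_pd {U : Set (EuclideanSpace ℝ (Fin n))} (hU : IsOpen U)
    {f : EuclideanSpace ℝ (Fin n) → ℝ} (hf : ContDiffOn ℝ ∞ f U) (i : Fin n) :
    ContDiffOn ℝ ∞ (pd i f) U := by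
  have := hf.fderiv_of_isOpen hU (m := ∞) (by simp)
  exact this.clm_apply contDiffOn_const

theorem differentiableAt_of_contDiffOn {E F : Type*} [NormedAddCommGroup E] [NormedSpace ℝ E]
    [NormedAddCommGroup F] [NormedSpace ℝ F] {U : Set E}
    (hU : IsOpen U) {f : E → F} (hf : ContDiffOn ℝ ∞ f U)
    {x : E} (hx : x ∈ U) : DifferentiableAt ℝ f x :=
  (hf.contDiffAt (hU.mem_nhds hx)).differentiableAt (by simp)

/-- Partial derivatives commute. -/
theorem pd_comm {U : Set (EuclideanSpace ℝ (Fin n))} (hU : IsOpen U)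
    {f : EuclideanSpace ℝ (Fin n) → ℝ} (hf : ContDiffOn ℝ ∞ f U) (i j : Fin n)
    {x : EuclideanSpace ℝ (Fin n)} (hx : x ∈ U) : pd i (pd j f) x = pd j (pd i f) x := by
  have hs : IsSymmSndFDerivAt ℝ f x :=
    (hf.contDiffAt (hU.mem_nhds hx)).isSymmSndFDerivAt
      (by simpa using WithTop.coe_le_coe.mpr (le_top (a := (2 : ℕ∞))))
  have hd : DifferentiableAt ℝ (fderiv ℝ f) x :=
    differentiableAt_of_contDiffOn hU (hf.fderiv_of_isOpen hU (m := ∞) (by simp)) hx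
  have h : ∀ k l : Fin n, pd k (pd l f) x
      = fderiv ℝ (fderiv ℝ f) x (EuclideanSpace.single k 1) (EuclideanSpace.single l 1) := by
    intro k l
    have : pd l f = fun y => fderiv ℝ f y (EuclideanSpace.single l 1) := rfl
    rw [pd, this, fderiv_clm_apply hd (differentiableAt_const _)]
    simp
  rw [h, h, hs]

end PartialDerivatives

/-! ### The Levi-Civita connection in coordinates -/

/-- The matrix field `h` is a smooth pseudo-Riemannian metric on the open set `V`. -/
structure IsMetricOn {n : ℕ} (h : EuclideanSpace ℝ (Fin n) → Matrix (Fin n) (Fin n) ℝ)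
    (V : Set (EuclideanSpace ℝ (Fin n))) : Prop where
  isOpen : IsOpen V
  contDiffOn (i j : Fin n) : ContDiffOn ℝ ∞ (fun y => h y i j) V
  symm {y : EuclideanSpace ℝ (Fin n)} (hy : y ∈ V) (i j : Fin n) : h y i j = h y j i
  det_ne_zero {y : EuclideanSpace ℝ (Fin n)} (hy : y ∈ V) : (h y).det ≠ 0

section Christoffel

variable {n : ℕ} {V : Set (EuclideanSpace ℝ (Fin n))}
  {h : EuclideanSpace ℝ (Fin n) → Matrix (Fin n) (Fin n) ℝ}

theorem contDiffOn_det {ι : Type*} [Fintype ι] [DecidableEq ι]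
    {A : EuclideanSpace ℝ (Fin n) → Matrix ι ι ℝ}
    (hA : ∀ i j, ContDiffOn ℝ ∞ (fun y => A y i j) V) :
    ContDiffOn ℝ ∞ (fun y => (A y).det) V := by
  simp only [Matrix.det_apply']
  exact ContDiffOn.sum fun σ _ => contDiffOn_const.mul (contDiffOn_prod fun i _ => hA _ _)

theorem IsMetricOn.contDiffOn_inv (hh : IsMetricOn h V) (i j : Fin n) :
    ContDiffOn ℝ ∞ (fun y => (h y)⁻¹ i j) V := by
  simp only [Matrix.inv_def, Ring.inverse_eq_inv', Matrix.smul_apply, smul_eq_mul,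
    Matrix.adjugate_apply]
  refine ((contDiffOn_det hh.contDiffOn).inv fun y hy => hh.det_ne_zero hy).mul
    (contDiffOn_det fun k l => ?_)
  simp only [Matrix.updateRow_apply]
  split_ifs
  · exact contDiffOn_const
  · exact hh.contDiffOn _ _

theorem IsMetricOn.contDiffOn_christoffel (hh : IsMetricOn h V) (k i j : Fin n) :
    ContDiffOn ℝ ∞ (christoffel h k i j) V := by
  have hpd := fun a p q => contDiffOn_pd hh.isOpen (hh.contDiffOn p q) a
  unfold christoffel
  refine contDiffOn_const.mul (ContDiffOn.sum fun l _ => (hh.contDiffOn_inv _ _).mul ?_)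
  exact ((hpd _ _ _).add (hpd _ _ _)).sub (hpd _ _ _)

/-- Lowering the upper index of the Christoffel symbols gives those of the first kind. -/
theorem sum_mul_christoffel {y : EuclideanSpace ℝ (Fin n)} (hdet : (h y).det ≠ 0)
    (l i j : Fin n) :
    ∑ k, h y l k * christoffel h k i j y = (1 / 2) *
      (pd i (fun y => h y l j) y + pd j (fun y => h y l i) y - pd l (fun y => h y i j) y) := by
  have key : ∀ w : Fin n → ℝ, ∑ k, h y l k * ∑ p, (h y)⁻¹ k p * w p = w l := by
    intro w
    have : h y *ᵥ ((h y)⁻¹ *ᵥ w) = w := by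
      rw [Matrix.mulVec_mulVec, Matrix.mul_nonsing_inv _ (isUnit_iff_ne_zero.mpr hdet),
        Matrix.one_mulVec]
    exact congrFun this l
  rw [← key fun l => (1 / 2) *
      (pd i (fun y => h y l j) y + pd j (fun y => h y l i) y - pd l (fun y => h y i j) y)]
  refine Finset.sum_congr rfl fun k _ => ?_
  rw [christoffel, Finset.mul_sum]
  congr 1
  refine Finset.sum_congr rfl fun p _ => ?_
  ring

theorem IsMetricOn.pd_symm (hh : IsMetricOn h V) {y : EuclideanSpace ℝ (Fin n)} (hy : y ∈ V)
    (a i j : Fin n) : pd a (fun y => h y i j) y = pd a (fun y => h y j i) y :=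
  pd_congr hh.isOpen (fun _ hz => hh.symm hz i j) hy

theorem IsMetricOn.christoffel_symm (hh : IsMetricOn h V) {y : EuclideanSpace ℝ (Fin n)}
    (hy : y ∈ V) (k i j : Fin n) : christoffel h k i j y = christoffel h k j i y := by
  unfold christoffel
  congr 1
  refine Finset.sum_congr rfl fun l _ => ?_
  rw [hh.pd_symm hy l i j]
  ring

/-- The metric is parallel for its Levi-Civita connection. -/
theorem IsMetricOn.pd_metric (hh : IsMetricOn h V) {y : EuclideanSpace ℝ (Fin n)} (hy : y ∈ V)
    (a i j : Fin n) : pd a (fun y => h y i j) y =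
      ∑ k, h y k j * christoffel h k a i y + ∑ k, h y i k * christoffel h k a j y := by
  have h3 : ∑ k, h y k j * christoffel h k a i y = ∑ k, h y j k * christoffel h k a i y :=
    Finset.sum_congr rfl fun k _ => by rw [hh.symm hy]
  rw [h3, sum_mul_christoffel (hh.det_ne_zero hy), sum_mul_christoffel (hh.det_ne_zero hy),
    hh.pd_symm hy a j i, hh.pd_symm hy i j a, hh.pd_symm hy j i a]
  ring

end Christoffel

/-! ### Covariant differentiation along a map -/

section Along

theorem sum_rotate {ι κ τ : Type*} [Fintype ι] [Fintype κ] [Fintype τ] (F : ι → κ → τ → ℝ) :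
    ∑ a, ∑ b, ∑ c, F a b c = ∑ b, ∑ c, ∑ a, F a b c := by
  rw [Finset.sum_comm]
  exact Finset.sum_congr rfl fun _ _ => Finset.sum_comm

theorem sum_reverse {ι κ τ : Type*} [Fintype ι] [Fintype κ] [Fintype τ] (F : ι → κ → τ → ℝ) :
    ∑ a, ∑ b, ∑ c, F a b c = ∑ c, ∑ b, ∑ a, F a b c := by
  rw [sum_rotate, Finset.sum_comm]

variable {m n : ℕ}

/-- The components of the coordinate velocity `∂_i φ` of a map `φ`. -/
def velocity (φ : EuclideanSpace ℝ (Fin m) → EuclideanSpace ℝ (Fin n)) (i : Fin m)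
    (z : EuclideanSpace ℝ (Fin m)) : Fin n → ℝ :=
  fun α => pd i (fun y => φ y α) z

/-- The covariant derivative `∇_i V` of a vector field `V` along `φ`, for the Levi-Civita
connection of the metric with components `h`. -/
def covAlong (h : EuclideanSpace ℝ (Fin n) → Matrix (Fin n) (Fin n) ℝ)
    (φ : EuclideanSpace ℝ (Fin m) → EuclideanSpace ℝ (Fin n)) (i : Fin m)
    (V : EuclideanSpace ℝ (Fin m) → Fin n → ℝ) (z : EuclideanSpace ℝ (Fin m)) : Fin n → ℝ :=
  fun μ => pd i (fun y => V y μ) z +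
    ∑ α, ∑ β, christoffel h μ α β (φ z) * velocity φ i z α * V z β

/-- The connection matrix of `∇_i` along `φ`. -/
def connMatrix (h : EuclideanSpace ℝ (Fin n) → Matrix (Fin n) (Fin n) ℝ)
    (φ : EuclideanSpace ℝ (Fin m) → EuclideanSpace ℝ (Fin n)) (i : Fin m)
    (μ β : Fin n) (z : EuclideanSpace ℝ (Fin m)) : ℝ :=
  ∑ α, christoffel h μ α β (φ z) * velocity φ i z α

/-- The curvature operator, `(R(v, w) u)^μ = R^μ_{βγδ} u^β v^γ w^δ`. -/
def curvature (h : EuclideanSpace ℝ (Fin n) → Matrix (Fin n) (Fin n) ℝ)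
    (y : EuclideanSpace ℝ (Fin n)) (v w u : Fin n → ℝ) : Fin n → ℝ :=
  fun μ => ∑ β, (∑ γ, ∑ δ, riemannUp h μ β γ δ y * v γ * w δ) * u β

/-- The scalar product of two vectors at the point `y`. -/
abbrev ip (h : EuclideanSpace ℝ (Fin n) → Matrix (Fin n) (Fin n) ℝ)
    (y : EuclideanSpace ℝ (Fin n)) : LinearMap.BilinForm ℝ (Fin n → ℝ) :=
  Matrix.toBilin' (h y)

theorem ip_apply (h : EuclideanSpace ℝ (Fin n) → Matrix (Fin n) (Fin n) ℝ)
    (y : EuclideanSpace ℝ (Fin n)) (v w : Fin n → ℝ) :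
    ip h y v w = ∑ μ, ∑ ν, h y μ ν * v μ * w ν := by
  rw [ip, Matrix.toBilin'_apply]
  exact Finset.sum_congr rfl fun _ _ => Finset.sum_congr rfl fun _ _ => by ring

theorem covAlong_eq_connMatrix (h : EuclideanSpace ℝ (Fin n) → Matrix (Fin n) (Fin n) ℝ)
    (φ : EuclideanSpace ℝ (Fin m) → EuclideanSpace ℝ (Fin n)) (i : Fin m)
    (V : EuclideanSpace ℝ (Fin m) → Fin n → ℝ) (z : EuclideanSpace ℝ (Fin m)) (μ : Fin n) :
    covAlong h φ i V z μ = pd i (fun y => V y μ) z + ∑ β, connMatrix h φ i μ β z * V z β := by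
  simp only [covAlong, connMatrix, Finset.sum_mul]
  rw [Finset.sum_comm]

variable {h : EuclideanSpace ℝ (Fin n) → Matrix (Fin n) (Fin n) ℝ}
  {V : Set (EuclideanSpace ℝ (Fin n))} {U : Set (EuclideanSpace ℝ (Fin m))}
  {φ : EuclideanSpace ℝ (Fin m) → EuclideanSpace ℝ (Fin n)} {z : EuclideanSpace ℝ (Fin m)}
  {X Y : EuclideanSpace ℝ (Fin m) → Fin n → ℝ}

/-- The map `φ` is smooth on the open set `U` and takes values in `V` there. -/
structure IsSmoothMap (φ : EuclideanSpace ℝ (Fin m) → EuclideanSpace ℝ (Fin n))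
    (U : Set (EuclideanSpace ℝ (Fin m))) (V : Set (EuclideanSpace ℝ (Fin n))) : Prop where
  isOpen : IsOpen U
  contDiffOn : ContDiffOn ℝ ∞ φ U
  mapsTo : Set.MapsTo φ U V

theorem ip_symm_of_symm {y : EuclideanSpace ℝ (Fin n)} (hy : ∀ i j, h y i j = h y j i)
    (v w : Fin n → ℝ) : ip h y v w = ip h y w v := by
  rw [ip_apply, ip_apply, Finset.sum_comm]
  refine Finset.sum_congr rfl fun _ _ => Finset.sum_congr rfl fun _ _ => ?_
  rw [hy]
  ring

theorem IsMetricOn.ip_symm (hh : IsMetricOn h V) {y : EuclideanSpace ℝ (Fin n)} (hy : y ∈ V)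
    (v w : Fin n → ℝ) : ip h y v w = ip h y w v :=
  ip_symm_of_symm (hh.symm hy) v w

theorem covAlong_congr (hU : IsOpen U) (hXY : ∀ y ∈ U, X y = Y y) (hz : z ∈ U) (i : Fin m) :
    covAlong h φ i X z = covAlong h φ i Y z := by
  funext μ
  rw [covAlong, covAlong, hXY z hz,
    pd_congr hU (f := fun y => X y μ) (g := fun y => Y y μ) (fun y hy => by rw [hXY y hy]) hz]

theorem covAlong_sub (hX : ∀ μ, DifferentiableAt ℝ (fun y => X y μ) z)
    (hY : ∀ μ, DifferentiableAt ℝ (fun y => Y y μ) z) (i : Fin m) :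
    covAlong h φ i (fun y => X y - Y y) z = covAlong h φ i X z - covAlong h φ i Y z := by
  funext μ
  simp only [covAlong_eq_connMatrix, Pi.sub_apply, pd_sub (hX μ) (hY μ), mul_sub,
    Finset.sum_sub_distrib]
  ring

theorem covAlong_smul {f : EuclideanSpace ℝ (Fin m) → ℝ} (hf : DifferentiableAt ℝ f z)
    (hX : ∀ μ, DifferentiableAt ℝ (fun y => X y μ) z) (i : Fin m) :
    covAlong h φ i (fun y => f y • X y) z = pd i f z • X z + f z • covAlong h φ i X z := by
  funext μ
  simp only [covAlong_eq_connMatrix, Pi.add_apply, Pi.smul_apply, smul_eq_mul,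
    pd_mul hf (hX μ), mul_add, Finset.mul_sum, add_assoc]
  congr 2
  exact Finset.sum_congr rfl fun _ _ => by ring

theorem covAlong_sum {ι : Type*} {s : Finset ι} {X : ι → EuclideanSpace ℝ (Fin m) → Fin n → ℝ}
    (hX : ∀ k ∈ s, ∀ μ, DifferentiableAt ℝ (fun y => X k y μ) z) (i : Fin m) :
    covAlong h φ i (fun y => ∑ k ∈ s, X k y) z = ∑ k ∈ s, covAlong h φ i (X k) z := by
  funext μ
  simp only [covAlong_eq_connMatrix, Finset.sum_apply, pd_sum fun k hk => hX k hk μ,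
    Finset.sum_add_distrib, Finset.mul_sum]
  rw [Finset.sum_comm]

theorem IsSmoothMap.differentiableAt (hφ : IsSmoothMap φ U V) (hz : z ∈ U) :
    DifferentiableAt ℝ φ z :=
  differentiableAt_of_contDiffOn hφ.isOpen hφ.contDiffOn hz

theorem IsSmoothMap.contDiffOn_coord (hφ : IsSmoothMap φ U V) (α : Fin n) :
    ContDiffOn ℝ ∞ (fun y => φ y α) U :=
  (EuclideanSpace.proj α : EuclideanSpace ℝ (Fin n) →L[ℝ] ℝ).contDiff.comp_contDiffOn hφ.contDiffOn

theorem IsSmoothMap.contDiffOn_velocity (hφ : IsSmoothMap φ U V) (i : Fin m) (α : Fin n) :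
    ContDiffOn ℝ ∞ (fun y => velocity φ i y α) U :=
  contDiffOn_pd hφ.isOpen (hφ.contDiffOn_coord α) i

theorem IsSmoothMap.contDiffOn_connMatrix (hφ : IsSmoothMap φ U V) (hh : IsMetricOn h V)
    (i : Fin m) (μ β : Fin n) : ContDiffOn ℝ ∞ (connMatrix h φ i μ β) U := by
  unfold connMatrix
  exact ContDiffOn.sum fun α _ =>
    ((hh.contDiffOn_christoffel μ α β).comp hφ.contDiffOn hφ.mapsTo).mul
      (hφ.contDiffOn_velocity i α)

theorem IsSmoothMap.contDiffOn_covAlong (hφ : IsSmoothMap φ U V) (hh : IsMetricOn h V)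
    (hX : ∀ μ, ContDiffOn ℝ ∞ (fun y => X y μ) U) (i : Fin m) (μ : Fin n) :
    ContDiffOn ℝ ∞ (fun y => covAlong h φ i X y μ) U := by
  simp only [covAlong_eq_connMatrix]
  exact (contDiffOn_pd hφ.isOpen (hX μ) i).add
    (ContDiffOn.sum fun β _ => (hφ.contDiffOn_connMatrix hh i μ β).mul (hX β))

theorem IsSmoothMap.contDiffOn_ip (hφ : IsSmoothMap φ U V) (hh : IsMetricOn h V)
    (hX : ∀ μ, ContDiffOn ℝ ∞ (fun y => X y μ) U) (hY : ∀ μ, ContDiffOn ℝ ∞ (fun y => Y y μ) U) :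
    ContDiffOn ℝ ∞ (fun y => ip h (φ y) (X y) (Y y)) U := by
  simp only [ip_apply]
  exact ContDiffOn.sum fun μ _ => ContDiffOn.sum fun ν _ =>
    (((hh.contDiffOn μ ν).comp hφ.contDiffOn hφ.mapsTo).mul (hX μ)).mul (hY ν)

/-- The Levi-Civita connection is torsion-free. -/
theorem IsSmoothMap.covAlong_velocity_comm (hφ : IsSmoothMap φ U V) (hh : IsMetricOn h V)
    (hz : z ∈ U) (i j : Fin m) :
    covAlong h φ i (velocity φ j) z = covAlong h φ j (velocity φ i) z := by
  funext μ
  have h1 : pd i (fun y => velocity φ j y μ) z = pd j (fun y => velocity φ i y μ) z :=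
    pd_comm hφ.isOpen (hφ.contDiffOn_coord μ) i j hz
  rw [covAlong, covAlong, h1, Finset.sum_comm]
  congr 1
  refine Finset.sum_congr rfl fun α _ => Finset.sum_congr rfl fun β _ => ?_
  rw [hh.christoffel_symm (hφ.mapsTo hz)]
  ring

/-- The structure equation: the curvature of the connection matrices along a map. -/
theorem IsSmoothMap.pd_connMatrix_sub (hφ : IsSmoothMap φ U V) (hh : IsMetricOn h V)
    (hz : z ∈ U) (i j : Fin m) (μ β : Fin n) :
    pd i (connMatrix h φ j μ β) z - pd j (connMatrix h φ i μ β) z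
      + ∑ δ, (connMatrix h φ i μ δ z * connMatrix h φ j δ β z
        - connMatrix h φ j μ δ z * connMatrix h φ i δ β z)
      = ∑ γ, ∑ δ, riemannUp h μ β γ δ (φ z) * velocity φ i z γ * velocity φ j z δ := by
  have hΓ : ∀ α, DifferentiableAt ℝ (christoffel h μ α β) (φ z) := fun α =>
    differentiableAt_of_contDiffOn hh.isOpen (hh.contDiffOn_christoffel μ α β) (hφ.mapsTo hz)
  have hφz := hφ.differentiableAt hz
  have hΓφ : ∀ α, DifferentiableAt ℝ (fun y => christoffel h μ α β (φ y)) z := fun α =>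
    (hΓ α).comp z hφz
  have hv : ∀ k α, DifferentiableAt ℝ (fun y => velocity φ k y α) z := fun k α =>
    differentiableAt_of_contDiffOn hφ.isOpen (hφ.contDiffOn_velocity k α) hz
  have hpd : ∀ k l, pd k (connMatrix h φ l μ β) z
      = (∑ γ, ∑ α, pd γ (christoffel h μ α β) (φ z) * velocity φ k z γ * velocity φ l z α)
        + ∑ α, christoffel h μ α β (φ z) * pd k (fun y => velocity φ l y α) z := by
    intro k l
    unfold connMatrix
    rw [pd_sum fun α _ => (hΓφ α).fun_mul (hv l α), Finset.sum_comm,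
      ← Finset.sum_add_distrib]
    refine Finset.sum_congr rfl fun α _ => ?_
    rw [pd_mul (hΓφ α) (hv l α), pd_comp (hΓ α) hφz, Finset.sum_mul]
    rfl
  have hcomm : ∀ α, pd i (fun y => velocity φ j y α) z = pd j (fun y => velocity φ i y α) z :=
    fun α => pd_comm hφ.isOpen (hφ.contDiffOn_coord α) i j hz
  have hquad : ∀ k l, ∑ δ, connMatrix h φ k μ δ z * connMatrix h φ l δ β z
      = ∑ γ, ∑ δ, (∑ p, christoffel h μ γ p (φ z) * christoffel h p δ β (φ z))
        * velocity φ k z γ * velocity φ l z δ := by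
    intro k l
    simp only [connMatrix, Finset.sum_mul_sum]
    rw [sum_rotate]
    simp only [Finset.sum_mul]
    exact Finset.sum_congr rfl fun _ _ => Finset.sum_congr rfl fun _ _ =>
      Finset.sum_congr rfl fun _ _ => by ring
  rw [Finset.sum_sub_distrib, hquad, hquad, hpd, hpd]
  simp only [hcomm, riemannUp, Finset.sum_sub_distrib]
  rw [Finset.sum_comm (f := fun γ α =>
      pd γ (christoffel h μ α β) (φ z) * velocity φ j z γ * velocity φ i z α),
    Finset.sum_comm (f := fun γ δ => (∑ p, christoffel h μ γ p (φ z) *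
      christoffel h p δ β (φ z)) * velocity φ j z γ * velocity φ i z δ)]
  simp only [add_mul, sub_mul, Finset.sum_add_distrib, Finset.sum_sub_distrib]
  simp only [mul_assoc, mul_comm (velocity φ j z _) (velocity φ i z _)]
  ring

/-- The commutator of covariant derivatives along a map is the curvature operator. -/
theorem IsSmoothMap.covAlong_comm (hφ : IsSmoothMap φ U V) (hh : IsMetricOn h V)
    (hX : ∀ μ, ContDiffOn ℝ ∞ (fun y => X y μ) U) (hz : z ∈ U) (i j : Fin m) :
    covAlong h φ i (covAlong h φ j X) z - covAlong h φ j (covAlong h φ i X) z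
      = curvature h (φ z) (velocity φ i z) (velocity φ j z) (X z) := by
  have hXd : ∀ μ, DifferentiableAt ℝ (fun y => X y μ) z := fun μ =>
    differentiableAt_of_contDiffOn hφ.isOpen (hX μ) hz
  have hA : ∀ k μ β, DifferentiableAt ℝ (connMatrix h φ k μ β) z := fun k μ β =>
    differentiableAt_of_contDiffOn hφ.isOpen (hφ.contDiffOn_connMatrix hh k μ β) hz
  have hpX : ∀ k μ, DifferentiableAt ℝ (pd k fun y => X y μ) z := fun k μ =>
    differentiableAt_of_contDiffOn hφ.isOpen (contDiffOn_pd hφ.isOpen (hX μ) k) hz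
  funext μ
  have h2 : ∀ k l, covAlong h φ k (covAlong h φ l X) z μ
      = pd k (pd l fun y => X y μ) z
        + ∑ β, (pd k (connMatrix h φ l μ β) z * X z β
          + connMatrix h φ l μ β z * pd k (fun y => X y β) z)
        + (∑ β, connMatrix h φ k μ β z * pd l (fun y => X y β) z
          + ∑ β, (∑ δ, connMatrix h φ k μ δ z * connMatrix h φ l δ β z) * X z β) := by
    intro k l
    rw [covAlong_eq_connMatrix]
    simp only [covAlong_eq_connMatrix]
    rw [pd_add (hpX l μ) (DifferentiableAt.fun_sum fun β _ => (hA l μ β).fun_mul (hXd β)),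
      pd_sum fun β _ => (hA l μ β).fun_mul (hXd β)]
    simp only [pd_mul (hA l μ _) (hXd _), mul_add, Finset.sum_add_distrib, Finset.mul_sum,
      Finset.sum_mul]
    congr 2
    rw [Finset.sum_comm]
    exact Finset.sum_congr rfl fun _ _ => Finset.sum_congr rfl fun _ _ => by ring
  rw [Pi.sub_apply, h2, h2, curvature]
  simp only [← hφ.pd_connMatrix_sub hh hz]
  rw [pd_comm hφ.isOpen (hX μ) i j hz]
  simp only [add_mul, sub_mul, Finset.sum_add_distrib, Finset.sum_sub_distrib]
  ring

/-- The product rule for the scalar product of vector fields along a map. -/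
theorem IsSmoothMap.pd_ip (hφ : IsSmoothMap φ U V) (hh : IsMetricOn h V) (hz : z ∈ U)
    (hX : ∀ μ, DifferentiableAt ℝ (fun y => X y μ) z)
    (hY : ∀ μ, DifferentiableAt ℝ (fun y => Y y μ) z) (i : Fin m) :
    pd i (fun y => ip h (φ y) (X y) (Y y)) z
      = ip h (φ z) (covAlong h φ i X z) (Y z) + ip h (φ z) (X z) (covAlong h φ i Y z) := by
  have hg : ∀ μ ν, DifferentiableAt ℝ (fun y => h y μ ν) (φ z) := fun μ ν =>
    differentiableAt_of_contDiffOn hh.isOpen (hh.contDiffOn μ ν) (hφ.mapsTo hz)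
  have hφz := hφ.differentiableAt hz
  have hgφ : ∀ μ ν, DifferentiableAt ℝ (fun y => h (φ y) μ ν) z := fun μ ν =>
    (hg μ ν).comp z hφz
  have h1 : ∀ μ ν, pd i (fun y => h (φ y) μ ν) z
      = ∑ k, h (φ z) k ν * connMatrix h φ i k μ z + ∑ k, h (φ z) μ k * connMatrix h φ i k ν z := by
    intro μ ν
    rw [pd_comp (hg μ ν) hφz]
    simp only [hh.pd_metric (hφ.mapsTo hz), connMatrix, add_mul, Finset.sum_add_distrib,
      Finset.sum_mul, Finset.mul_sum]
    congr 1 <;> rw [Finset.sum_comm] <;>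
      exact Finset.sum_congr rfl fun _ _ => Finset.sum_congr rfl fun _ _ => by
        rw [mul_assoc]; rfl
  simp only [ip_apply, covAlong_eq_connMatrix]
  rw [pd_sum fun μ _ => DifferentiableAt.fun_sum fun ν _ =>
    ((hgφ μ ν).fun_mul (hX μ)).fun_mul (hY ν)]
  simp only [pd_sum fun ν _ => ((hgφ _ ν).fun_mul (hX _)).fun_mul (hY ν),
    pd_mul ((hgφ _ _).fun_mul (hX _)) (hY _), pd_mul (hgφ _ _) (hX _), h1]
  simp only [add_mul, mul_add, Finset.sum_add_distrib, Finset.sum_mul, Finset.mul_sum]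
  have e1 : ∑ μ, ∑ ν, ∑ k, h (φ z) k ν * connMatrix h φ i k μ z * X z μ * Y z ν
      = ∑ μ, ∑ ν, ∑ k, h (φ z) μ ν * (connMatrix h φ i μ k z * X z k) * Y z ν := by
    rw [sum_reverse]
    exact Finset.sum_congr rfl fun _ _ => Finset.sum_congr rfl fun _ _ =>
      Finset.sum_congr rfl fun _ _ => by ring
  have e2 : ∑ μ, ∑ ν, ∑ k, h (φ z) μ k * connMatrix h φ i k ν z * X z μ * Y z ν
      = ∑ μ, ∑ ν, ∑ k, h (φ z) μ ν * X z μ * (connMatrix h φ i ν k z * Y z k) := by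
    refine Finset.sum_congr rfl fun _ _ => ?_
    rw [Finset.sum_comm]
    exact Finset.sum_congr rfl fun _ _ => Finset.sum_congr rfl fun _ _ => by ring
  rw [e1, e2]
  ring

end Along

/-! ### Symmetries and contractions of the curvature tensor -/

section Curvature

variable {n : ℕ} {h : EuclideanSpace ℝ (Fin n) → Matrix (Fin n) (Fin n) ℝ}
  {V : Set (EuclideanSpace ℝ (Fin n))} {y : EuclideanSpace ℝ (Fin n)}

theorem ip_curvature (u' u v w : Fin n → ℝ) :
    ip h y u' (curvature h y v w u)
      = ∑ a, ∑ b, ∑ c, ∑ d, riemann h a b c d y * u' a * u b * v c * w d := by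
  rw [ip_apply]
  refine Finset.sum_congr rfl fun a _ => ?_
  simp only [curvature, riemann, Finset.mul_sum, Finset.sum_mul]
  rw [Finset.sum_comm]
  refine Finset.sum_congr rfl fun b _ => ?_
  rw [sum_rotate]
  refine Finset.sum_congr rfl fun c _ => Finset.sum_congr rfl fun d _ =>
    Finset.sum_congr rfl fun k _ => ?_
  ring

/-- The curvature operators are skew-adjoint. The vectors `v` and `w` are realized as the
coordinate velocities of an affine map from the plane, and `u`, `u'` as constant fields along it;
the claim is then the symmetry of the second derivatives of their scalar product. -/
theorem IsMetricOn.ip_curvature_skew (hh : IsMetricOn h V) (hy : y ∈ V) (u' u v w : Fin n → ℝ) :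
    ip h y (curvature h y v w u) u' = -ip h y u (curvature h y v w u') := by
  set φ : EuclideanSpace ℝ (Fin 2) → EuclideanSpace ℝ (Fin n) := fun s =>
    y + (s 0 • WithLp.toLp 2 v + s 1 • WithLp.toLp 2 w) with hφdef
  have hφs : ContDiff ℝ ∞ φ := by
    have : ∀ i : Fin 2, ContDiff ℝ ∞ fun s : EuclideanSpace ℝ (Fin 2) => s i := fun i =>
      (EuclideanSpace.proj i : EuclideanSpace ℝ (Fin 2) →L[ℝ] ℝ).contDiff
    exact contDiff_const.add (((this 0).smul contDiff_const).add ((this 1).smul contDiff_const))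
  have hφ : IsSmoothMap φ (φ ⁻¹' V) V :=
    ⟨hh.isOpen.preimage hφs.continuous, hφs.contDiffOn, fun _ hs => hs⟩
  have h0 : φ 0 = y := by simp [hφdef]
  have hz : (0 : EuclideanSpace ℝ (Fin 2)) ∈ φ ⁻¹' V := by simpa [h0] using hy
  have hvel : ∀ i, velocity φ i 0 = if i = 0 then v else w := by
    intro i
    funext α
    have hd : ∀ (j : Fin 2) (a : ℝ), DifferentiableAt ℝ
        (fun s : EuclideanSpace ℝ (Fin 2) => s j * a) 0 := fun j a =>
      ((EuclideanSpace.proj j : EuclideanSpace ℝ (Fin 2) →L[ℝ] ℝ).differentiableAt).mul_const a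
    have hp : ∀ j : Fin 2, DifferentiableAt ℝ (fun s : EuclideanSpace ℝ (Fin 2) => s j) 0 :=
      fun j => (EuclideanSpace.proj j : EuclideanSpace ℝ (Fin 2) →L[ℝ] ℝ).differentiableAt
    have he : (fun s => φ s α) = fun s => y α + (s 0 * v α + s 1 * w α) := by
      funext s
      simp [hφdef]
    rw [velocity, he, pd_add (differentiableAt_const _) ((hd 0 _).fun_add (hd 1 _)),
      pd_add (hd 0 _) (hd 1 _), pd_mul (hp 0) (differentiableAt_const _),
      pd_mul (hp 1) (differentiableAt_const _)]
    simp only [pd_const, pd_coord]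
    fin_cases i <;> simp
  set X : EuclideanSpace ℝ (Fin 2) → Fin n → ℝ := fun _ => u with hX
  set Y : EuclideanSpace ℝ (Fin 2) → Fin n → ℝ := fun _ => u' with hY
  have sX : ∀ μ, ContDiffOn ℝ ∞ (fun s => X s μ) (φ ⁻¹' V) := fun μ => contDiffOn_const
  have sY : ∀ μ, ContDiffOn ℝ ∞ (fun s => Y s μ) (φ ⁻¹' V) := fun μ => contDiffOn_const
  have dd := fun {f : EuclideanSpace ℝ (Fin 2) → ℝ} (hf : ContDiffOn ℝ ∞ f (φ ⁻¹' V))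
    {s : EuclideanSpace ℝ (Fin 2)} (hs : s ∈ φ ⁻¹' V) =>
    differentiableAt_of_contDiffOn hφ.isOpen hf hs
  have cX := fun i μ => hφ.contDiffOn_covAlong hh sX i μ
  have cY := fun i μ => hφ.contDiffOn_covAlong hh sY i μ
  have second : ∀ i j : Fin 2, pd i (pd j fun s => ip h (φ s) (X s) (Y s)) 0
      = ip h y (covAlong h φ i (covAlong h φ j X) 0) u' + ip h y (covAlong h φ j X 0)
          (covAlong h φ i Y 0) + (ip h y (covAlong h φ i X 0) (covAlong h φ j Y 0)
        + ip h y u (covAlong h φ i (covAlong h φ j Y) 0)) := by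
    intro i j
    rw [pd_congr hφ.isOpen (fun s hs =>
        hφ.pd_ip hh hs (fun μ => dd (sX μ) hs) (fun μ => dd (sY μ) hs) j) hz,
      pd_add (dd (hφ.contDiffOn_ip hh (cX j) sY) hz) (dd (hφ.contDiffOn_ip hh sX (cY j)) hz),
      hφ.pd_ip hh hz (fun μ => dd (cX j μ) hz) (fun μ => dd (sY μ) hz),
      hφ.pd_ip hh hz (fun μ => dd (sX μ) hz) (fun μ => dd (cY j μ) hz), h0]
  have hcomm := pd_comm hφ.isOpen (hφ.contDiffOn_ip hh sX sY) 0 1 hz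
  rw [second, second] at hcomm
  have eX := hφ.covAlong_comm hh sX hz 0 1
  have eY := hφ.covAlong_comm hh sY hz 0 1
  simp only [hvel, h0, if_true, one_ne_zero, if_false] at eX eY
  rw [← eX, ← eY, map_sub, map_sub, LinearMap.sub_apply]
  linarith

end Curvature

/-! ### Orthogonal decomposition with respect to a hypersurface -/

section Frame

variable {A : Matrix (Fin 4) (Fin 4) ℝ} {γ : Matrix (Fin 3) (Fin 3) ℝ}
  {v : Fin 3 → Fin 4 → ℝ} {n : Fin 4 → ℝ}

/-- The matrix with rows `v_1, v_2, v_3, n`. -/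
def frameMatrix (v : Fin 3 → Fin 4 → ℝ) (n : Fin 4 → ℝ) : Matrix (Fin 4) (Fin 4) ℝ :=
  Matrix.of ![v 0, v 1, v 2, n]

/-- The vectors `v_1, v_2, v_3, n` form a frame adapted to a hypersurface with unit timelike
normal `n`: with respect to the metric `A` the tangent vectors `v_i` have scalar products `γ`. -/
structure IsAdaptedFrame (A : Matrix (Fin 4) (Fin 4) ℝ) (γ : Matrix (Fin 3) (Fin 3) ℝ)
    (v : Fin 3 → Fin 4 → ℝ) (n : Fin 4 → ℝ) : Prop where
  tangent (i j : Fin 3) : Matrix.toBilin' A (v i) (v j) = γ i j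
  tangent_normal (i : Fin 3) : Matrix.toBilin' A (v i) n = 0
  normal_tangent (i : Fin 3) : Matrix.toBilin' A n (v i) = 0
  normal : Matrix.toBilin' A n n = -1
  det_ne_zero : γ.det ≠ 0

/-- The matrix of the metric in an adapted frame. -/
def adaptedMetric (γ : Matrix (Fin 3) (Fin 3) ℝ) : Matrix (Fin 4) (Fin 4) ℝ :=
  !![γ 0 0, γ 0 1, γ 0 2, 0; γ 1 0, γ 1 1, γ 1 2, 0; γ 2 0, γ 2 1, γ 2 2, 0; 0, 0, 0, -1]

theorem det_adaptedMetric (γ : Matrix (Fin 3) (Fin 3) ℝ) : (adaptedMetric γ).det = -γ.det := by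
  rw [Matrix.det_succ_row _ 3]
  simp [Fin.sum_univ_four, adaptedMetric, Matrix.det_fin_three, Fin.succAbove]
  ring

theorem IsAdaptedFrame.frameMatrix_mul (hF : IsAdaptedFrame A γ v n) :
    frameMatrix v n * A * (frameMatrix v n)ᵀ = adaptedMetric γ := by
  have key : ∀ a b, (frameMatrix v n * A * (frameMatrix v n)ᵀ) a b
      = Matrix.toBilin' A (frameMatrix v n a) (frameMatrix v n b) := by
    intro a b
    rw [Matrix.toBilin'_apply', Matrix.mul_assoc]
    rfl
  ext a b
  rw [key]
  fin_cases a <;> fin_cases b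
  exacts [hF.tangent 0 0, hF.tangent 0 1, hF.tangent 0 2, hF.tangent_normal 0,
    hF.tangent 1 0, hF.tangent 1 1, hF.tangent 1 2, hF.tangent_normal 1,
    hF.tangent 2 0, hF.tangent 2 1, hF.tangent 2 2, hF.tangent_normal 2,
    hF.normal_tangent 0, hF.normal_tangent 1, hF.normal_tangent 2, hF.normal]

theorem IsAdaptedFrame.det_mul_det (hF : IsAdaptedFrame A γ v n) :
    (frameMatrix v n).det ^ 2 * A.det = -γ.det := by
  rw [← det_adaptedMetric, ← hF.frameMatrix_mul, Matrix.det_mul, Matrix.det_mul,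
    Matrix.det_transpose]
  ring

theorem IsAdaptedFrame.det_frame_ne_zero (hF : IsAdaptedFrame A γ v n) :
    (frameMatrix v n).det ≠ 0 := by
  intro h
  have := hF.det_mul_det
  rw [h] at this
  exact hF.det_ne_zero (by linarith)

theorem IsAdaptedFrame.det_metric_ne_zero (hF : IsAdaptedFrame A γ v n) : A.det ≠ 0 := by
  intro h
  have := hF.det_mul_det
  rw [h] at this
  exact hF.det_ne_zero (by linarith)

/-- A vector orthogonal to an adapted frame vanishes. -/
theorem IsAdaptedFrame.eq_zero (hF : IsAdaptedFrame A γ v n) {w : Fin 4 → ℝ}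
    (hv : ∀ i, Matrix.toBilin' A (v i) w = 0) (hn : Matrix.toBilin' A n w = 0) : w = 0 := by
  have h1 : (frameMatrix v n * A) *ᵥ w = 0 := by
    funext a
    have : ((frameMatrix v n * A) *ᵥ w) a = Matrix.toBilin' A (frameMatrix v n a) w := by
      rw [Matrix.toBilin'_apply', ← Matrix.mulVec_mulVec]
      rfl
    rw [this]
    fin_cases a
    exacts [hv 0, hv 1, hv 2, hn]
  refine Matrix.eq_zero_of_mulVec_eq_zero ?_ h1
  rw [Matrix.det_mul]
  exact mul_ne_zero hF.det_frame_ne_zero hF.det_metric_ne_zero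

/-- The decomposition of a vector into its tangential and normal parts. -/
theorem IsAdaptedFrame.decomposition (hF : IsAdaptedFrame A γ v n) (w : Fin 4 → ℝ) :
    w = ∑ k, (∑ l, γ⁻¹ k l * Matrix.toBilin' A (v l) w) • v k - Matrix.toBilin' A n w • n := by
  have hγ : ∀ (p : Fin 3) (f : Fin 3 → ℝ), ∑ k, (∑ l, γ⁻¹ k l * f l) * γ p k = f p := by
    intro p f
    have : γ *ᵥ (γ⁻¹ *ᵥ f) = f := by
      rw [Matrix.mulVec_mulVec, Matrix.mul_nonsing_inv _ (isUnit_iff_ne_zero.mpr hF.det_ne_zero),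
        Matrix.one_mulVec]
    have h2 := congrFun this p
    rw [← h2]
    exact Finset.sum_congr rfl fun k _ => mul_comm _ _
  rw [← sub_eq_zero]
  refine hF.eq_zero (fun p => ?_) ?_
  · simp only [map_sub, map_sum, map_smul, smul_eq_mul, hF.tangent, hF.tangent_normal, hγ]
    ring
  · simp only [map_sub, map_sum, map_smul, smul_eq_mul, hF.normal_tangent, hF.normal]
    simp

/-- The trace of a linear map in an adapted frame. -/
theorem IsAdaptedFrame.sum_diag (hF : IsAdaptedFrame A γ v n) (T : Matrix (Fin 4) (Fin 4) ℝ) :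
    ∑ a, T a a = ∑ k, ∑ l, γ⁻¹ k l * Matrix.toBilin' A (v l) (T *ᵥ v k)
      - Matrix.toBilin' A n (T *ᵥ n) := by
  have hB : ∀ u x : Fin 4 → ℝ,
      ∑ a, Matrix.toBilin' A u (Pi.single a 1) * x a = Matrix.toBilin' A u x := by
    intro u x
    conv_rhs => rw [pi_eq_sum_univ' x, map_sum]
    refine Finset.sum_congr rfl fun a _ => ?_
    rw [map_smul, smul_eq_mul, mul_comm]
  have hT : ∀ a, T a a = ∑ k, (∑ l, γ⁻¹ k l * Matrix.toBilin' A (v l) (Pi.single a 1))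
      * (T *ᵥ v k) a - Matrix.toBilin' A n (Pi.single a 1) * (T *ᵥ n) a := by
    intro a
    have h1 : T a a = (T *ᵥ Pi.single a 1) a := by simp
    rw [h1]
    conv_lhs => rw [hF.decomposition (Pi.single a 1)]
    simp [Matrix.mulVec_sub, Matrix.mulVec_sum, Matrix.mulVec_smul]
  simp only [hT, Finset.sum_sub_distrib, hB]
  congr 1
  rw [Finset.sum_comm]
  refine Finset.sum_congr rfl fun k _ => ?_
  simp only [Finset.sum_mul]
  rw [Finset.sum_comm]
  refine Finset.sum_congr rfl fun l _ => ?_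
  rw [← hB, Finset.mul_sum]
  exact Finset.sum_congr rfl fun a _ => mul_assoc _ _ _

end Frame

/-! ### The equations of Gauss and Codazzi -/

section Hypersurface

/-- The second fundamental form `K_{ij} = -h(∂_i φ, ∇_j N)` of a parametrized hypersurface `φ`
with unit normal `N`. -/
def secondForm (h : EuclideanSpace ℝ (Fin 4) → Matrix (Fin 4) (Fin 4) ℝ)
    (φ : EuclideanSpace ℝ (Fin 3) → EuclideanSpace ℝ (Fin 4))
    (N : EuclideanSpace ℝ (Fin 3) → Fin 4 → ℝ) (z : EuclideanSpace ℝ (Fin 3)) :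
    Matrix (Fin 3) (Fin 3) ℝ :=
  Matrix.of fun i j => -ip h (φ z) (velocity φ i z) (covAlong h φ j N z)

/-- A parametrized hypersurface `φ : U → V` with unit timelike normal `N` and nondegenerate induced
metric `γ`. -/
structure IsParamHypersurface (h : EuclideanSpace ℝ (Fin 4) → Matrix (Fin 4) (Fin 4) ℝ)
    (V : Set (EuclideanSpace ℝ (Fin 4)))
    (γ : EuclideanSpace ℝ (Fin 3) → Matrix (Fin 3) (Fin 3) ℝ)
    (U : Set (EuclideanSpace ℝ (Fin 3)))
    (φ : EuclideanSpace ℝ (Fin 3) → EuclideanSpace ℝ (Fin 4))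
    (N : EuclideanSpace ℝ (Fin 3) → Fin 4 → ℝ) : Prop where
  metric : IsMetricOn h V
  map : IsSmoothMap φ U V
  contDiffOn_normal (μ : Fin 4) : ContDiffOn ℝ ∞ (fun y => N y μ) U
  induced {z : EuclideanSpace ℝ (Fin 3)} (hz : z ∈ U) (i j : Fin 3) :
    γ z i j = ip h (φ z) (velocity φ i z) (velocity φ j z)
  unit {z : EuclideanSpace ℝ (Fin 3)} (hz : z ∈ U) : ip h (φ z) (N z) (N z) = -1
  orthogonal {z : EuclideanSpace ℝ (Fin 3)} (hz : z ∈ U) (i : Fin 3) :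
    ip h (φ z) (N z) (velocity φ i z) = 0
  det_induced_ne_zero {z : EuclideanSpace ℝ (Fin 3)} (hz : z ∈ U) : (γ z).det ≠ 0

namespace IsParamHypersurface

variable {h : EuclideanSpace ℝ (Fin 4) → Matrix (Fin 4) (Fin 4) ℝ}
  {V : Set (EuclideanSpace ℝ (Fin 4))}
  {γ : EuclideanSpace ℝ (Fin 3) → Matrix (Fin 3) (Fin 3) ℝ}
  {U : Set (EuclideanSpace ℝ (Fin 3))}
  {φ : EuclideanSpace ℝ (Fin 3) → EuclideanSpace ℝ (Fin 4)}
  {N : EuclideanSpace ℝ (Fin 3) → Fin 4 → ℝ} {z : EuclideanSpace ℝ (Fin 3)}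

theorem isAdaptedFrame (P : IsParamHypersurface h V γ U φ N) (hz : z ∈ U) :
    IsAdaptedFrame (h (φ z)) (γ z) (fun i => velocity φ i z) (N z) where
  tangent i j := (P.induced hz i j).symm
  tangent_normal i := by
    rw [← P.orthogonal hz i]
    exact P.metric.ip_symm (P.map.mapsTo hz) _ _
  normal_tangent i := P.orthogonal hz i
  normal := P.unit hz
  det_ne_zero := P.det_induced_ne_zero hz

theorem diff_velocity (P : IsParamHypersurface h V γ U φ N) (hz : z ∈ U) (i : Fin 3) (α : Fin 4) :
    DifferentiableAt ℝ (fun y => velocity φ i y α) z :=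
  differentiableAt_of_contDiffOn P.map.isOpen (P.map.contDiffOn_velocity i α) hz

theorem diff_normal (P : IsParamHypersurface h V γ U φ N) (hz : z ∈ U) (α : Fin 4) :
    DifferentiableAt ℝ (fun y => N y α) z :=
  differentiableAt_of_contDiffOn P.map.isOpen (P.contDiffOn_normal α) hz

theorem isMetricOn_induced (P : IsParamHypersurface h V γ U φ N) : IsMetricOn γ U where
  isOpen := P.map.isOpen
  contDiffOn i j := (P.map.contDiffOn_ip P.metric (P.map.contDiffOn_velocity i)
    (P.map.contDiffOn_velocity j)).congr fun z hz => P.induced hz i j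
  symm hz i j := by
    rw [P.induced hz, P.induced hz]
    exact P.metric.ip_symm (P.map.mapsTo hz) _ _
  det_ne_zero hz := P.det_induced_ne_zero hz

theorem contDiffOn_secondForm (P : IsParamHypersurface h V γ U φ N) (i j : Fin 3) :
    ContDiffOn ℝ ∞ (fun y => secondForm h φ N y i j) U :=
  (P.map.contDiffOn_ip P.metric (P.map.contDiffOn_velocity i)
    (P.map.contDiffOn_covAlong P.metric P.contDiffOn_normal j)).neg

theorem ip_normal_covAlong_velocity (P : IsParamHypersurface h V γ U φ N) (hz : z ∈ U)
    (i j : Fin 3) :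
    ip h (φ z) (N z) (covAlong h φ j (velocity φ i) z) = secondForm h φ N z i j := by
  have h1 := P.map.pd_ip P.metric hz (P.diff_normal hz) (P.diff_velocity hz i) j
  rw [pd_congr P.map.isOpen (fun y hy => P.orthogonal hy i) hz, pd_const,
    P.metric.ip_symm (P.map.mapsTo hz) (covAlong h φ j N z)] at h1
  rw [secondForm, Matrix.of_apply]
  linarith

theorem secondForm_symm (P : IsParamHypersurface h V γ U φ N) (hz : z ∈ U) (i j : Fin 3) :
    secondForm h φ N z i j = secondForm h φ N z j i := by
  rw [← P.ip_normal_covAlong_velocity hz, ← P.ip_normal_covAlong_velocity hz,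
    P.map.covAlong_velocity_comm P.metric hz]

theorem ip_normal_covAlong_normal (P : IsParamHypersurface h V γ U φ N) (hz : z ∈ U)
    (j : Fin 3) : ip h (φ z) (N z) (covAlong h φ j N z) = 0 := by
  have h1 := P.map.pd_ip P.metric hz (P.diff_normal hz) (P.diff_normal hz) j
  rw [pd_congr P.map.isOpen (fun y hy => P.unit hy) hz, pd_const,
    P.metric.ip_symm (P.map.mapsTo hz) (covAlong h φ j N z)] at h1
  linarith

/-- The Koszul formula for the tangential part of `∇_i ∂_j φ`. -/
theorem ip_velocity_covAlong_velocity (P : IsParamHypersurface h V γ U φ N) (hz : z ∈ U)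
    (l i j : Fin 3) :
    ip h (φ z) (velocity φ l z) (covAlong h φ i (velocity φ j) z) = (1 / 2) *
      (pd i (fun y => γ y l j) z + pd j (fun y => γ y l i) z - pd l (fun y => γ y i j) z) := by
  have h1 : ∀ a p q, pd a (fun y => γ y p q) z
      = ip h (φ z) (velocity φ q z) (covAlong h φ a (velocity φ p) z)
        + ip h (φ z) (velocity φ p z) (covAlong h φ a (velocity φ q) z) := by
    intro a p q
    rw [pd_congr P.map.isOpen (fun y hy => P.induced hy p q) hz,
      P.map.pd_ip P.metric hz (P.diff_velocity hz p) (P.diff_velocity hz q),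
      P.metric.ip_symm (P.map.mapsTo hz) (covAlong h φ a (velocity φ p) z)]
  rw [h1, h1, h1, P.map.covAlong_velocity_comm P.metric hz i l,
    P.map.covAlong_velocity_comm P.metric hz j l, P.map.covAlong_velocity_comm P.metric hz j i]
  ring

/-- The Gauss formula: the Levi-Civita connection of the ambient metric splits into the induced
connection and the second fundamental form. -/
theorem covAlong_velocity (P : IsParamHypersurface h V γ U φ N) (hz : z ∈ U) (j l : Fin 3) :
    covAlong h φ j (velocity φ l) z
      = ∑ m, christoffel γ m j l z • velocity φ m z - secondForm h φ N z l j • N z := by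
  rw [(P.isAdaptedFrame hz).decomposition (covAlong h φ j (velocity φ l) z)]
  congr 1
  · refine Finset.sum_congr rfl fun m _ => ?_
    congr 1
    rw [christoffel, Finset.mul_sum]
    refine Finset.sum_congr rfl fun p _ => ?_
    rw [P.ip_velocity_covAlong_velocity hz]
    ring
  · rw [P.ip_normal_covAlong_velocity hz]

theorem ip_velocity_normal (P : IsParamHypersurface h V γ U φ N) (hz : z ∈ U) (i : Fin 3) :
    ip h (φ z) (velocity φ i z) (N z) = 0 :=
  (P.isAdaptedFrame hz).tangent_normal i

/-- The Gauss equation. -/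
theorem gauss_equation (P : IsParamHypersurface h V γ U φ N) (hz : z ∈ U) (k l i j : Fin 3) :
    ip h (φ z) (velocity φ k z)
        (curvature h (φ z) (velocity φ i z) (velocity φ j z) (velocity φ l z))
      = riemann γ k l i j z + secondForm h φ N z k i * secondForm h φ N z l j
        - secondForm h φ N z k j * secondForm h φ N z l i := by
  have dΓ : ∀ a b c, DifferentiableAt ℝ (christoffel γ a b c) z := fun a b c =>
    differentiableAt_of_contDiffOn P.map.isOpen
      (P.isMetricOn_induced.contDiffOn_christoffel a b c) hz
  have dK : ∀ a b, DifferentiableAt ℝ (fun y => secondForm h φ N y a b) z := fun a b =>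
    differentiableAt_of_contDiffOn P.map.isOpen (P.contDiffOn_secondForm a b) hz
  -- the tangential part of `∇_a ∇_b ∂_l`, from the Gauss formula applied twice
  have hcov : ∀ a b, ip h (φ z) (velocity φ k z) (covAlong h φ a (covAlong h φ b (velocity φ l)) z)
      = ∑ p, γ z k p * (pd a (christoffel γ p b l) z
          + ∑ m, christoffel γ p a m z * christoffel γ m b l z)
        + secondForm h φ N z k a * secondForm h φ N z l b * (-1) * (-1) := by
    intro a b
    have dX : ∀ m μ, DifferentiableAt ℝ
        (fun y => (christoffel γ m b l y • velocity φ m y) μ) z := fun m μ =>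
      (dΓ m b l).fun_mul (P.diff_velocity hz m μ)
    have dY : ∀ μ, DifferentiableAt ℝ (fun y => (secondForm h φ N y l b • N y) μ) z := fun μ =>
      (dK l b).fun_mul (P.diff_normal hz μ)
    rw [covAlong_congr P.map.isOpen (fun y hy => P.covAlong_velocity hy b l) hz,
      covAlong_sub (fun μ => by
        simpa only [Finset.sum_apply] using DifferentiableAt.fun_sum fun m _ => dX m μ) dY,
      covAlong_sum fun m _ => dX m, covAlong_smul (dK l b) (P.diff_normal hz)]
    simp only [covAlong_smul (dΓ _ b l) (P.diff_velocity hz _), map_sub, map_add, map_sum,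
      map_smul, smul_eq_mul, P.covAlong_velocity hz, P.ip_velocity_normal hz, ← P.induced hz]
    have hK : ip h (φ z) (velocity φ k z) (covAlong h φ a N z) = -secondForm h φ N z k a := by
      simp [secondForm]
    rw [hK]
    have e : ∑ p, γ z k p * (pd a (christoffel γ p b l) z
          + ∑ m, christoffel γ p a m z * christoffel γ m b l z)
        = ∑ m, (pd a (christoffel γ m b l) z * γ z k m
          + christoffel γ m b l z * ∑ p, christoffel γ p a m z * γ z k p) := by
      simp only [mul_add, Finset.sum_add_distrib, Finset.mul_sum]
      rw [Finset.sum_comm (f := fun p m =>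
        γ z k p * (christoffel γ p a m z * christoffel γ m b l z))]
      congr 1
      · exact Finset.sum_congr rfl fun _ _ => mul_comm _ _
      · exact Finset.sum_congr rfl fun _ _ => Finset.sum_congr rfl fun _ _ => by ring
    rw [e]
    simp only [mul_zero, sub_zero]
    ring
  rw [← P.map.covAlong_comm P.metric (P.map.contDiffOn_velocity l) hz, map_sub, hcov, hcov]
  simp only [riemann, riemannUp, mul_add, mul_sub, Finset.sum_add_distrib, Finset.sum_sub_distrib]
  ring

/-- The Codazzi equation. The second covariant derivatives of the normal are obtained by
differentiating `K_{ib} = -h(∂_i, ∇_b N)`; the normal part of `∇_a ∂_i` does not contribute because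
`∇_b N` is tangential, and the Christoffel terms in the index `b` cancel by symmetry. -/
theorem codazzi_equation (P : IsParamHypersurface h V γ U φ N) (hz : z ∈ U) (i l s : Fin 3) :
    ip h (φ z) (velocity φ i z) (curvature h (φ z) (velocity φ l z) (velocity φ s z) (N z))
      = covDeriv γ (secondForm h φ N) s i l z - covDeriv γ (secondForm h φ N) l i s z := by
  have cN := fun a μ => P.map.contDiffOn_covAlong P.metric P.contDiffOn_normal a μ
  have hcov : ∀ a b, ip h (φ z) (velocity φ i z) (covAlong h φ a (covAlong h φ b N) z)
      = -pd a (fun y => secondForm h φ N y i b) z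
        + ∑ m, christoffel γ m a i z * secondForm h φ N z m b := by
    intro a b
    have h1 := P.map.pd_ip P.metric hz (P.diff_velocity hz i)
      (fun μ => differentiableAt_of_contDiffOn P.map.isOpen (cN b μ) hz) a
    have h2 : pd a (fun y => secondForm h φ N y i b) z
        = -pd a (fun y => ip h (φ y) (velocity φ i y) (covAlong h φ b N y)) z := by
      simp [secondForm, pd, fderiv_fun_neg]
    rw [h2, h1, P.covAlong_velocity hz]
    simp only [map_sub, map_sum, map_smul, LinearMap.sub_apply, LinearMap.sum_apply,
      LinearMap.smul_apply, smul_eq_mul, P.ip_normal_covAlong_normal hz, secondForm,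
      Matrix.of_apply, mul_neg, Finset.sum_neg_distrib]
    ring
  have hΓ : ∀ m, christoffel γ m l s z = christoffel γ m s l z := fun m =>
    P.isMetricOn_induced.christoffel_symm hz m l s
  rw [← P.map.covAlong_comm P.metric P.contDiffOn_normal hz, map_sub, hcov, hcov]
  simp only [covDeriv, hΓ]
  ring

end IsParamHypersurface

end Hypersurface

/-! ### The Weyl tensor of an Einstein metric -/

section Einstein

/-- The Ricci tensor `Ric(u, w)` is the trace of the map `v ↦ R(v, w) u`. -/
theorem sum_ricci_eq_trace {n : ℕ} (h : EuclideanSpace ℝ (Fin n) → Matrix (Fin n) (Fin n) ℝ)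
    (y : EuclideanSpace ℝ (Fin n)) (u w : Fin n → ℝ) :
    ∑ i, ∑ j, ricci h i j y * u i * w j
      = ∑ a, (Matrix.of fun a c => ∑ b, ∑ d, riemannUp h a b c d y * u b * w d) a a := by
  simp only [ricci, Finset.sum_mul, Matrix.of_apply]
  exact (sum_rotate (fun a i j => riemannUp h a i a j y * u i * w j)).symm

theorem mulVec_eq_curvature {n : ℕ} (h : EuclideanSpace ℝ (Fin n) → Matrix (Fin n) (Fin n) ℝ)
    (y : EuclideanSpace ℝ (Fin n)) (u v w : Fin n → ℝ) :
    (Matrix.of fun a c => ∑ b, ∑ d, riemannUp h a b c d y * u b * w d) *ᵥ v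
      = curvature h y v w u := by
  funext a
  simp only [Matrix.mulVec, dotProduct, Matrix.of_apply, curvature, Finset.sum_mul]
  rw [Finset.sum_comm]
  exact Finset.sum_congr rfl fun _ _ => Finset.sum_congr rfl fun _ _ =>
    Finset.sum_congr rfl fun _ _ => by ring

variable {h : EuclideanSpace ℝ (Fin 4) → Matrix (Fin 4) (Fin 4) ℝ}
  {V : Set (EuclideanSpace ℝ (Fin 4))} {y : EuclideanSpace ℝ (Fin 4)} {Λ : ℝ}

theorem IsMetricOn.scalarCurvature_of_vacuum (hh : IsMetricOn h V) (hy : y ∈ V)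
    (hvac : ∀ μ ν, ricci h μ ν y - (1 / 2) * scalarCurvature h y * h y μ ν + Λ * h y μ ν = 0) :
    scalarCurvature h y = 4 * Λ := by
  have h1 : ∑ i, ∑ j, (h y)⁻¹ i j * h y i j = 4 := by
    have h2 : ∀ i, ∑ j, (h y)⁻¹ i j * h y i j = 1 := by
      intro i
      have : ((h y)⁻¹ * h y) i i = 1 := by
        rw [Matrix.nonsing_inv_mul _ (isUnit_iff_ne_zero.mpr (hh.det_ne_zero hy))]
        simp
      rw [← this, Matrix.mul_apply]
      exact Finset.sum_congr rfl fun j _ => by rw [hh.symm hy]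
    simp [h2]
  -- the trace of the vacuum equations
  have h3 : scalarCurvature h y
      = (1 / 2 * scalarCurvature h y - Λ) * ∑ i, ∑ j, (h y)⁻¹ i j * h y i j := by
    conv_lhs => rw [scalarCurvature]
    simp only [Finset.mul_sum]
    refine Finset.sum_congr rfl fun i _ => Finset.sum_congr rfl fun j _ => ?_
    linear_combination (h y)⁻¹ i j * hvac i j
  rw [h1] at h3
  linarith

theorem IsMetricOn.ricci_of_vacuum (hh : IsMetricOn h V) (hy : y ∈ V)
    (hvac : ∀ μ ν, ricci h μ ν y - (1 / 2) * scalarCurvature h y * h y μ ν + Λ * h y μ ν = 0)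
    (μ ν : Fin 4) : ricci h μ ν y = Λ * h y μ ν := by
  have := hvac μ ν
  rw [hh.scalarCurvature_of_vacuum hy hvac] at this
  linarith

/-- For an Einstein metric the Weyl tensor is the curvature tensor minus its constant curvature
part. -/
theorem IsMetricOn.weyl_of_vacuum (hh : IsMetricOn h V) (hy : y ∈ V)
    (hvac : ∀ μ ν, ricci h μ ν y - (1 / 2) * scalarCurvature h y * h y μ ν + Λ * h y μ ν = 0)
    (a b c d : Fin 4) : weyl h a b c d y
      = riemann h a b c d y - Λ / 3 * (h y a c * h y b d - h y a d * h y b c) := by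
  rw [weyl, hh.scalarCurvature_of_vacuum hy hvac]
  simp only [hh.ricci_of_vacuum hy hvac]
  rw [hh.symm hy d b, hh.symm hy c b, hh.symm hy d a, hh.symm hy c a]
  ring

theorem IsMetricOn.sum_weyl_of_vacuum (hh : IsMetricOn h V) (hy : y ∈ V)
    (hvac : ∀ μ ν, ricci h μ ν y - (1 / 2) * scalarCurvature h y * h y μ ν + Λ * h y μ ν = 0)
    (p q r s : Fin 4 → ℝ) :
    ∑ a, ∑ b, ∑ c, ∑ d, weyl h a b c d y * p a * q b * r c * s d
      = ip h y p (curvature h y r s q)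
        - Λ / 3 * (ip h y p r * ip h y q s - ip h y p s * ip h y q r) := by
  have e1 : ip h y p r * ip h y q s
      = ∑ a, ∑ b, ∑ c, ∑ d, h y a c * h y b d * p a * q b * r c * s d := by
    simp only [ip_apply, Finset.sum_mul_sum]
    exact Finset.sum_congr rfl fun _ _ => Finset.sum_congr rfl fun _ _ =>
      Finset.sum_congr rfl fun _ _ => Finset.sum_congr rfl fun _ _ => by ring
  have e2 : ip h y p s * ip h y q r
      = ∑ a, ∑ b, ∑ c, ∑ d, h y a d * h y b c * p a * q b * r c * s d := by
    simp only [ip_apply, Finset.sum_mul_sum]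
    refine Finset.sum_congr rfl fun _ _ => Finset.sum_congr rfl fun _ _ => ?_
    rw [Finset.sum_comm]
    exact Finset.sum_congr rfl fun _ _ => Finset.sum_congr rfl fun _ _ => by ring
  rw [ip_curvature, e1, e2]
  simp only [← Finset.sum_sub_distrib, Finset.mul_sum]
  refine Finset.sum_congr rfl fun _ _ => Finset.sum_congr rfl fun _ _ =>
      Finset.sum_congr rfl fun _ _ => Finset.sum_congr rfl fun _ _ => ?_
  rw [hh.weyl_of_vacuum hy hvac]
  ring

end Einstein

/-! ### The electric part -/

namespace IsParamHypersurface

variable {h : EuclideanSpace ℝ (Fin 4) → Matrix (Fin 4) (Fin 4) ℝ}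
  {V : Set (EuclideanSpace ℝ (Fin 4))}
  {γ : EuclideanSpace ℝ (Fin 3) → Matrix (Fin 3) (Fin 3) ℝ}
  {U : Set (EuclideanSpace ℝ (Fin 3))}
  {φ : EuclideanSpace ℝ (Fin 3) → EuclideanSpace ℝ (Fin 4)}
  {N : EuclideanSpace ℝ (Fin 3) → Fin 4 → ℝ} {z : EuclideanSpace ℝ (Fin 3)} {Λ : ℝ}

/-- The trace of the Gauss equation. -/
theorem trace_gauss_equation (P : IsParamHypersurface h V γ U φ N) (hz : z ∈ U) (i j : Fin 3) :
    ∑ k, ∑ l, (γ z)⁻¹ k l * ip h (φ z) (velocity φ l z)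
        (curvature h (φ z) (velocity φ k z) (velocity φ j z) (velocity φ i z))
      = ricci γ i j z
        + (∑ k, ∑ l, (γ z)⁻¹ k l * secondForm h φ N z k l) * secondForm h φ N z i j
        - ∑ k, ∑ l, secondForm h φ N z i k * (γ z)⁻¹ k l * secondForm h φ N z l j := by
  have h1 : ∑ k, ∑ l, (γ z)⁻¹ k l * riemann γ l i k j z = ricci γ i j z := by
    refine Finset.sum_congr rfl fun k _ => ?_
    have : (γ z)⁻¹ *ᵥ (γ z *ᵥ fun m => riemannUp γ m i k j z) = fun m => riemannUp γ m i k j z := by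
      rw [Matrix.mulVec_mulVec,
        Matrix.nonsing_inv_mul _ (isUnit_iff_ne_zero.mpr (P.det_induced_ne_zero hz)),
        Matrix.one_mulVec]
    exact congrFun this k
  rw [← h1]
  simp only [P.gauss_equation hz, mul_add, mul_sub, Finset.sum_add_distrib,
    Finset.sum_sub_distrib, Finset.sum_mul]
  congr 1
  · congr 1
    refine Finset.sum_congr rfl fun k _ => Finset.sum_congr rfl fun l _ => ?_
    rw [P.secondForm_symm hz l k]
    ring
  · exact Finset.sum_congr rfl fun k _ => Finset.sum_congr rfl fun l _ => by ring

/-- The contraction `R(∂_i, n, n, ∂_j)` of the curvature tensor of an Einstein metric: evaluating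
the Ricci tensor as a trace in the adapted frame expresses it through the tangential components,
which the Gauss equation computes. -/
theorem ip_velocity_curvature_normal (P : IsParamHypersurface h V γ U φ N) (hz : z ∈ U)
    (hric : ∀ μ ν, ricci h μ ν (φ z) = Λ * h (φ z) μ ν) (i j : Fin 3) :
    ip h (φ z) (velocity φ i z) (curvature h (φ z) (N z) (velocity φ j z) (N z))
      = Λ * γ z i j - ricci γ i j z
        - (∑ k, ∑ l, (γ z)⁻¹ k l * secondForm h φ N z k l) * secondForm h φ N z i j
        + ∑ k, ∑ l, secondForm h φ N z i k * (γ z)⁻¹ k l * secondForm h φ N z l j := by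
  have hy := P.map.mapsTo hz
  have h1 := sum_ricci_eq_trace h (φ z) (velocity φ i z) (velocity φ j z)
  have h0 : ∑ a, ∑ b, ricci h a b (φ z) * velocity φ i z a * velocity φ j z b = Λ * γ z i j := by
    rw [P.induced hz, ip_apply, Finset.mul_sum]
    refine Finset.sum_congr rfl fun a _ => ?_
    rw [Finset.mul_sum]
    refine Finset.sum_congr rfl fun b _ => ?_
    rw [hric]
    ring
  rw [h0, (P.isAdaptedFrame hz).sum_diag] at h1
  simp only [mulVec_eq_curvature] at h1
  have h2 := P.trace_gauss_equation hz i j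
  -- `R(∂_i, n, n, ∂_j) = -R(n, ∂_i, n, ∂_j)`, the normal contribution to the trace
  have h3 := P.metric.ip_curvature_skew hy (velocity φ i z) (N z) (N z) (velocity φ j z)
  rw [P.metric.ip_symm hy] at h3
  unfold ip at h2 h3 ⊢
  rw [h2] at h1
  rw [h3]
  linarith

/-- The electric part of the Weyl tensor of a vacuum metric, in coordinates. -/
theorem electric_eq (P : IsParamHypersurface h V γ U φ N) (hz : z ∈ U)
    (hvac : ∀ μ ν, ricci h μ ν (φ z) - (1 / 2) * scalarCurvature h (φ z) * h (φ z) μ ν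
      + Λ * h (φ z) μ ν = 0) (i j : Fin 3) :
    ∑ α, ∑ β, (∑ μ, ∑ ν, weyl h α μ ν β (φ z) * N z μ * N z ν)
        * velocity φ i z α * velocity φ j z β
      = -ricci γ i j z
        - (∑ k, ∑ l, (γ z)⁻¹ k l * secondForm h φ N z k l) * secondForm h φ N z i j
        + ∑ k, ∑ l, secondForm h φ N z i k * (γ z)⁻¹ k l * secondForm h φ N z l j
        + (2 / 3) * Λ * γ z i j := by
  have h1 : ∑ α, ∑ β, (∑ μ, ∑ ν, weyl h α μ ν β (φ z) * N z μ * N z ν)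
        * velocity φ i z α * velocity φ j z β
      = ∑ a, ∑ b, ∑ c, ∑ d, weyl h a b c d (φ z) * velocity φ i z a * N z b * N z c
          * velocity φ j z d := by
    refine Finset.sum_congr rfl fun α _ => ?_
    simp only [Finset.sum_mul]
    rw [sum_rotate]
    exact Finset.sum_congr rfl fun _ _ => Finset.sum_congr rfl fun _ _ =>
      Finset.sum_congr rfl fun _ _ => by ring
  rw [h1, P.metric.sum_weyl_of_vacuum (P.map.mapsTo hz) hvac,
    P.ip_velocity_curvature_normal hz (P.metric.ricci_of_vacuum (P.map.mapsTo hz) hvac),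
    P.ip_velocity_normal hz, P.unit hz, ← P.induced hz]
  ring

end IsParamHypersurface

/-! ### The antisymmetric tensors -/

section LeviCivita

theorem sum_comm_pairs {ι κ τ υ : Type*} [Fintype ι] [Fintype κ] [Fintype τ] [Fintype υ]
    (F : ι → κ → τ → υ → ℝ) :
    ∑ a, ∑ b, ∑ c, ∑ d, F a b c d = ∑ c, ∑ d, ∑ a, ∑ b, F a b c d := by
  rw [← sum_rotate (fun a c d => ∑ b, F a b c d)]
  exact Finset.sum_congr rfl fun _ _ => sum_rotate _

/-- The expansion of the determinant as a multilinear function of the rows. -/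
theorem det_eq_sum_leviCivitaSymbol {n : ℕ} (M : Matrix (Fin n) (Fin n) ℝ) :
    M.det = ∑ f : Fin n → Fin n, leviCivitaSymbol f * ∏ i, M i (f i) := by
  have h1 : M = fun i => ∑ j, M i j • (fun k => if j = k then (1 : ℝ) else 0) := by
    ext i k
    simp
  have h2 : M.det = Matrix.detRowAlternating M := rfl
  rw [h2]
  conv_lhs => rw [h1]
  rw [← AlternatingMap.coe_multilinearMap, MultilinearMap.map_sum]
  refine Finset.sum_congr rfl fun f _ => ?_
  rw [MultilinearMap.map_smul_univ, smul_eq_mul, mul_comm]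
  rfl

theorem sum_vecCons {ι : Type*} [Fintype ι] {n : ℕ} (F : (Fin (n + 1) → ι) → ℝ) :
    ∑ f, F f = ∑ a, ∑ g : Fin n → ι, F (Matrix.vecCons a g) := by
  rw [← Fintype.sum_prod_type']
  exact (Fintype.sum_equiv (Fin.consEquiv fun _ => ι) _ _ fun _ => rfl).symm

theorem sum_leviCivitaSymbol_three (u v w : Fin 3 → ℝ) :
    ∑ p, ∑ q, ∑ r, leviCivitaSymbol ![p, q, r] * (u p * v q * w r)
      = (Matrix.of ![u, v, w]).det := by
  rw [det_eq_sum_leviCivitaSymbol]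
  simp only [sum_vecCons, Fintype.sum_unique, Fin.prod_univ_three]
  rfl

theorem sum_leviCivitaSymbol_four (u v w x : Fin 4 → ℝ) :
    ∑ p, ∑ q, ∑ r, ∑ s, leviCivitaSymbol ![p, q, r, s] * (u p * v q * w r * x s)
      = (Matrix.of ![u, v, w, x]).det := by
  rw [det_eq_sum_leviCivitaSymbol]
  simp only [sum_vecCons, Fintype.sum_unique, Fin.prod_univ_four]
  rfl

theorem leviCivitaSymbol_swap (p q r : Fin 3) :
    leviCivitaSymbol ![q, p, r] = -leviCivitaSymbol ![p, q, r] := by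
  have h1 : ![q, p, r] = ![p, q, r] ∘ Equiv.swap 0 1 := by
    ext i
    fin_cases i <;> rfl
  rw [h1]
  exact Matrix.detRowAlternating.map_swap
    (fun i j => if ![p, q, r] i = j then (1 : ℝ) else 0)
    (show (0 : Fin 3) ≠ 1 by decide)

theorem epsilonMixed3_swap (γ : EuclideanSpace ℝ (Fin 3) → Matrix (Fin 3) (Fin 3) ℝ)
    (p q j : Fin 3) (z : EuclideanSpace ℝ (Fin 3)) :
    epsilonMixed3 γ q p j z = -epsilonMixed3 γ p q j z := by
  simp only [epsilonMixed3, epsilonUp, ← Finset.sum_neg_distrib]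
  refine Finset.sum_congr rfl fun r _ => ?_
  rw [leviCivitaSymbol_swap]
  ring

end LeviCivita

section Frame

variable {h : EuclideanSpace ℝ (Fin 4) → Matrix (Fin 4) (Fin 4) ℝ}
  {γ : EuclideanSpace ℝ (Fin 3) → Matrix (Fin 3) (Fin 3) ℝ}
  {y : EuclideanSpace ℝ (Fin 4)} {z : EuclideanSpace ℝ (Fin 3)}
  {v : Fin 3 → Fin 4 → ℝ} {n : Fin 4 → ℝ}

/-- The volume normalizations of the metric and of the induced metric agree. -/
theorem IsAdaptedFrame.sqrt_det (hF : IsAdaptedFrame (h y) (γ z) v n)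
    (hpos : 0 < (frameMatrix v n).det) :
    √|(h y).det| * (frameMatrix v n).det = √|(γ z).det| := by
  have h1 : |(γ z).det| = |(h y).det| * (frameMatrix v n).det ^ 2 := by
    rw [← abs_neg, ← hF.det_mul_det, abs_mul, abs_of_pos (by positivity), mul_comm]
  rw [h1, Real.sqrt_mul (abs_nonneg _), Real.sqrt_sq hpos.le]

theorem adaptedMetric_castSucc (G : Matrix (Fin 3) (Fin 3) ℝ) (a : Fin 3) :
    adaptedMetric G a.castSucc = ![G a 0, G a 1, G a 2, 0] := by
  fin_cases a <;> rfl

/-- The two signs, from the position of the normal row and from its entry `-1`, cancel. -/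
theorem det_adaptedMetric_rows (G : Matrix (Fin 3) (Fin 3) ℝ) (a b j : Fin 3) :
    (Matrix.of ![adaptedMetric G a.castSucc, adaptedMetric G b.castSucc, adaptedMetric G 3,
      adaptedMetric G j.castSucc]).det = (Matrix.of ![G a, G b, G j]).det := by
  have h3 : adaptedMetric G 3 = ![0, 0, 0, -1] := rfl
  rw [adaptedMetric_castSucc, adaptedMetric_castSucc, adaptedMetric_castSucc, h3,
    Matrix.det_succ_row _ 2]
  simp [Fin.sum_univ_four, Matrix.det_fin_three, Fin.succAbove]
  ring

theorem frameMatrix_castSucc (v : Fin 3 → Fin 4 → ℝ) (n : Fin 4 → ℝ) (a : Fin 3) :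
    frameMatrix v n a.castSucc = v a := by
  fin_cases a <;> rfl

/-- Contracting `ε^{λσ}_{νβ}` with the normal in `ν` and a tangent vector in `β` leaves the
three-dimensional antisymmetric tensor of the induced metric, `ε^{pq}_j ∂_p^λ ∂_q^σ`. Both sides are
bivectors; they agree because their pairings with the covectors obtained by lowering the indices of
the adapted frame are the same determinants. -/
theorem IsAdaptedFrame.epsilonMixed4_contract (hF : IsAdaptedFrame (h y) (γ z) v n)
    (hsymm : ∀ μ ν, h y μ ν = h y ν μ) (hγ : ∀ i j, γ z i j = γ z j i)
    (hpos : 0 < (frameMatrix v n).det) (j : Fin 3) (l d : Fin 4) :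
    ∑ ν, ∑ β, epsilonMixed4 h l d ν β y * n ν * v j β
      = ∑ p, ∑ q, epsilonMixed3 γ p q j z * v p l * v q d := by
  set F := frameMatrix v n with hFdef
  -- the rows of `L` are the frame vectors with lowered indices
  set L := F * h y with hL
  have hrow : ∀ a r, L a r = ∑ ν, h y r ν * F a ν := by
    intro a r
    rw [hL, Matrix.mul_apply]
    exact Finset.sum_congr rfl fun ν _ => by rw [hsymm]; ring
  have hLF : L * Fᵀ = adaptedMetric (γ z) := hF.frameMatrix_mul
  have hLunit : IsUnit L := by
    rw [Matrix.isUnit_iff_isUnit_det, hL, Matrix.det_mul, isUnit_iff_ne_zero]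
    exact mul_ne_zero hpos.ne' hF.det_metric_ne_zero
  set Q : Matrix (Fin 4) (Fin 4) ℝ :=
    Matrix.of fun l d => ∑ ν, ∑ β, epsilonMixed4 h l d ν β y * n ν * v j β with hQ
  set Q' : Matrix (Fin 4) (Fin 4) ℝ :=
    Matrix.of fun l d => ∑ p, ∑ q, epsilonMixed3 γ p q j z * v p l * v q d with hQ'
  have conj : ∀ (T : Matrix (Fin 4) (Fin 4) ℝ) a b,
      (L * T * Lᵀ) a b = ∑ l, ∑ d, T l d * L a l * L b d := by
    intro T a b
    simp only [Matrix.mul_apply, Matrix.transpose_apply, Finset.sum_mul]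
    rw [Finset.sum_comm]
    exact Finset.sum_congr rfl fun _ _ => Finset.sum_congr rfl fun _ _ => by ring
  have hQa : ∀ l d, Q l d = ∑ r, ∑ t, leviCivitaSymbol ![l, d, r, t] / √|(h y).det|
      * (L 3 r * L j.castSucc t) := by
    intro l d
    have hn : F 3 = n := rfl
    simp only [hQ, Matrix.of_apply, epsilonMixed4, epsilonUp, hrow, hFdef,
      frameMatrix_castSucc, Finset.mul_sum, Finset.sum_mul]
    rw [sum_comm_pairs]
    refine Finset.sum_congr rfl fun _ _ => Finset.sum_congr rfl fun _ _ => ?_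
    rw [Finset.sum_comm]
    exact Finset.sum_congr rfl fun _ _ => Finset.sum_congr rfl fun _ _ => by rw [← hFdef, hn]; ring
  have hQ1 : ∀ a b, (L * Q * Lᵀ) a b
      = (Matrix.of ![adaptedMetric (γ z) a, adaptedMetric (γ z) b, adaptedMetric (γ z) 3,
          adaptedMetric (γ z) j.castSucc]).det / √|(γ z).det| := by
    intro a b
    have h1 : (L * Q * Lᵀ) a b
        = (Matrix.of ![L a, L b, L 3, L j.castSucc]).det / √|(h y).det| := by
      rw [conj, ← sum_leviCivitaSymbol_four]
      simp only [hQa, Finset.sum_mul, Finset.sum_div]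
      exact Finset.sum_congr rfl fun _ _ => Finset.sum_congr rfl fun _ _ =>
        Finset.sum_congr rfl fun _ _ => Finset.sum_congr rfl fun _ _ => by ring
    have h2 : Matrix.of ![adaptedMetric (γ z) a, adaptedMetric (γ z) b, adaptedMetric (γ z) 3,
        adaptedMetric (γ z) j.castSucc] = Matrix.of ![L a, L b, L 3, L j.castSucc] * Fᵀ := by
      rw [← hLF]
      ext r s
      fin_cases r <;> rfl
    rw [h1, h2, Matrix.det_mul, Matrix.det_transpose, ← hF.sqrt_det hpos, ← hFdef]
    have := hpos.ne'
    field_simp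
  have hQ2 : ∀ a b, (L * Q' * Lᵀ) a b
      = ∑ p, ∑ q, epsilonMixed3 γ p q j z * adaptedMetric (γ z) a p.castSucc
          * adaptedMetric (γ z) b q.castSucc := by
    intro a b
    have h1 : ∀ a (p : Fin 3), adaptedMetric (γ z) a p.castSucc = ∑ l, L a l * v p l := by
      intro a p
      rw [← hLF, Matrix.mul_apply]
      exact Finset.sum_congr rfl fun l _ => by
        rw [Matrix.transpose_apply, hFdef, frameMatrix_castSucc]
    rw [conj]
    simp only [h1, hQ', Matrix.of_apply, mul_assoc, Finset.mul_sum,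
      Finset.sum_mul]
    rw [sum_comm_pairs]
    refine Finset.sum_congr rfl fun _ _ => Finset.sum_congr rfl fun _ _ => ?_
    rw [Finset.sum_comm]
    exact Finset.sum_congr rfl fun _ _ => Finset.sum_congr rfl fun _ _ => by ring
  have hQQ : L * Q * Lᵀ = L * Q' * Lᵀ := by
    ext a b
    rw [hQ1, hQ2]
    -- a pairing with the normal vanishes on both sides: two equal rows, and orthogonality
    have hlast : ∀ p : Fin 3, adaptedMetric (γ z) 3 p.castSucc = 0 := by
      intro p
      fin_cases p <;> rfl
    have hcast : ∀ a p : Fin 3, adaptedMetric (γ z) a.castSucc p.castSucc = γ z a p := by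
      intro a p
      fin_cases a <;> fin_cases p <;> rfl
    induction a using Fin.lastCases with
    | last =>
      rw [Matrix.det_zero_of_row_eq (i := 0) (j := 2) (by decide) rfl, zero_div]
      exact (Finset.sum_eq_zero fun p _ => Finset.sum_eq_zero fun q _ => by
        rw [show Fin.last 3 = 3 from rfl, hlast]; ring).symm
    | cast a =>
      induction b using Fin.lastCases with
      | last =>
        rw [Matrix.det_zero_of_row_eq (i := 1) (j := 2) (by decide) rfl, zero_div]
        exact (Finset.sum_eq_zero fun p _ => Finset.sum_eq_zero fun q _ => by
          rw [show Fin.last 3 = 3 from rfl, hlast]; ring).symm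
      | cast b =>
        rw [det_adaptedMetric_rows, ← sum_leviCivitaSymbol_three]
        simp only [hcast, epsilonMixed3, epsilonUp, Finset.sum_mul, Finset.sum_div]
        exact Finset.sum_congr rfl fun _ _ => Finset.sum_congr rfl fun _ _ =>
          Finset.sum_congr rfl fun r _ => by rw [hγ j r]; ring
  have hLT : IsUnit Lᵀ := by
    rw [Matrix.isUnit_iff_isUnit_det, Matrix.det_transpose, ← Matrix.isUnit_iff_isUnit_det]
    exact hLunit
  have hfin : Q = Q' := hLunit.mul_left_cancel (hLT.mul_right_cancel hQQ)
  exact congrFun (congrFun hfin l) d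

end Frame

/-! ### The magnetic part -/

namespace IsParamHypersurface

variable {h : EuclideanSpace ℝ (Fin 4) → Matrix (Fin 4) (Fin 4) ℝ}
  {V : Set (EuclideanSpace ℝ (Fin 4))}
  {γ : EuclideanSpace ℝ (Fin 3) → Matrix (Fin 3) (Fin 3) ℝ}
  {U : Set (EuclideanSpace ℝ (Fin 3))}
  {φ : EuclideanSpace ℝ (Fin 3) → EuclideanSpace ℝ (Fin 4)}
  {N : EuclideanSpace ℝ (Fin 3) → Fin 4 → ℝ} {z : EuclideanSpace ℝ (Fin 3)} {Λ : ℝ}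

/-- The magnetic part of the Weyl tensor of a vacuum metric, in coordinates. -/
theorem magnetic_eq (P : IsParamHypersurface h V γ U φ N) (hz : z ∈ U)
    (hvac : ∀ μ ν, ricci h μ ν (φ z) - (1 / 2) * scalarCurvature h (φ z) * h (φ z) μ ν
      + Λ * h (φ z) μ ν = 0)
    (hpos : 0 < (frameMatrix (fun i => velocity φ i z) (N z)).det) (i j : Fin 3) :
    ∑ α, ∑ β, (∑ μ, ∑ ν, weylDual h α μ ν β (φ z) * N z μ * N z ν)
        * velocity φ i z α * velocity φ j z β
      = ∑ l, ∑ s, epsilonMixed3 γ l s j z * covDeriv γ (secondForm h φ N) s i l z := by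
  have hy := P.map.mapsTo hz
  have h1 : ∑ α, ∑ β, (∑ μ, ∑ ν, weylDual h α μ ν β (φ z) * N z μ * N z ν)
        * velocity φ i z α * velocity φ j z β
      = ∑ α, ∑ μ, (1 / 2) * ∑ l, ∑ d, weyl h α μ l d (φ z) * velocity φ i z α * N z μ
          * ∑ ν, ∑ β, epsilonMixed4 h l d ν β (φ z) * N z ν * velocity φ j z β := by
    refine Finset.sum_congr rfl fun α _ => ?_
    simp only [weylDual, Finset.sum_mul, Finset.mul_sum]
    rw [Finset.sum_comm]
    refine Finset.sum_congr rfl fun μ _ => ?_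
    rw [Finset.sum_comm, sum_comm_pairs]
    exact Finset.sum_congr rfl fun _ _ => Finset.sum_congr rfl fun _ _ =>
      Finset.sum_congr rfl fun _ _ => Finset.sum_congr rfl fun _ _ => by ring
  have h2 : ∑ α, ∑ μ, (1 / 2) * ∑ l, ∑ d, weyl h α μ l d (φ z) * velocity φ i z α * N z μ
          * ∑ p, ∑ q, epsilonMixed3 γ p q j z * velocity φ p z l * velocity φ q z d
      = ∑ p, ∑ q, (1 / 2) * epsilonMixed3 γ p q j z * ∑ a, ∑ b, ∑ c, ∑ d, weyl h a b c d (φ z)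
          * velocity φ i z a * N z b * velocity φ p z c * velocity φ q z d := by
    simp only [Finset.mul_sum]
    conv_rhs => rw [sum_comm_pairs]
    refine Finset.sum_congr rfl fun a _ => Finset.sum_congr rfl fun b _ => ?_
    rw [sum_comm_pairs]
    exact Finset.sum_congr rfl fun _ _ => Finset.sum_congr rfl fun _ _ =>
      Finset.sum_congr rfl fun _ _ => Finset.sum_congr rfl fun _ _ => by ring
  rw [h1]
  simp only [(P.isAdaptedFrame hz).epsilonMixed4_contract (fun μ ν => P.metric.symm hy μ ν)
    (fun a b => P.isMetricOn_induced.symm hz a b) hpos j]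
  rw [h2]
  simp only [P.metric.sum_weyl_of_vacuum hy hvac, P.codazzi_equation hz, P.orthogonal hz, mul_zero,
    sub_zero, mul_sub, Finset.sum_sub_distrib]
  have h3 : ∑ p, ∑ q, 1 / 2 * epsilonMixed3 γ p q j z * covDeriv γ (secondForm h φ N) p i q z
      = -∑ p, ∑ q, 1 / 2 * epsilonMixed3 γ p q j z * covDeriv γ (secondForm h φ N) q i p z := by
    rw [Finset.sum_comm]
    simp only [← Finset.sum_neg_distrib]
    refine Finset.sum_congr rfl fun p _ => Finset.sum_congr rfl fun q _ => ?_
    rw [epsilonMixed3_swap γ p q]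
    ring
  -- the two Codazzi terms agree by antisymmetry of `ε`, which absorbs the factor `1 / 2`
  rw [h3, sub_neg_eq_add, ← Finset.sum_add_distrib]
  refine Finset.sum_congr rfl fun p _ => ?_
  rw [← Finset.sum_add_distrib]
  exact Finset.sum_congr rfl fun q _ => by ring

end IsParamHypersurface

/-! ### Components in charts -/

section Charts

theorem sum_smul_map_single {n : ℕ}
    (A B : EuclideanSpace ℝ (Fin n) →L[ℝ] EuclideanSpace ℝ (Fin n))
    (v : EuclideanSpace ℝ (Fin n)) (h : A (B v) = v) :
    ∑ μ, (B v) μ • A (EuclideanSpace.single μ 1) = v := by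
  conv_rhs => rw [← h, ← sum_smul_single (B v), map_sum]
  simp only [map_smul]

theorem bilin_sum_smul {ι E : Type*} [Fintype ι] [NormedAddCommGroup E] [NormedSpace ℝ E]
    (B : E →L[ℝ] E →L[ℝ] ℝ) (a b : ι → ℝ) (w : ι → E) :
    B (∑ i, a i • w i) (∑ j, b j • w j) = ∑ i, ∑ j, B (w i) (w j) * a i * b j := by
  simp only [map_sum, map_smul, sum_apply, smul_apply, smul_eq_mul, Finset.mul_sum]
  rw [Finset.sum_comm]
  exact Finset.sum_congr rfl fun _ _ => Finset.sum_congr rfl fun _ _ => by ring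

variable {n : ℕ} {M : Type*} [TopologicalSpace M] [ChartedSpace (EuclideanSpace ℝ (Fin n)) M]
  {e : OpenPartialHomeomorph M (EuclideanSpace ℝ (Fin n))}

theorem mdifferentiable_of_mem_maximalAtlas (he : e ∈ IsManifold.maximalAtlas (𝓡 n) ∞ M) :
    e.MDifferentiable (𝓡 n) (𝓡 n) :=
  ⟨(contMDiffOn_of_mem_maximalAtlas he).mdifferentiableOn (by simp),
    (contMDiffOn_symm_of_mem_maximalAtlas he).mdifferentiableOn (by simp)⟩

/-- A tangent vector is the combination of the coordinate vectors by its components. The identity is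
read in the model space, since `coordVec e (e q) μ` is based at `e.symm (e q)`. -/
theorem sum_vecComp_smul_coordVec (he : e ∈ IsManifold.maximalAtlas (𝓡 n) ∞ M) {q : M}
    (hq : q ∈ e.source) (v : TangentSpace (𝓡 n) q) :
    (∑ μ, vecComp e v μ • (coordVec e (e q) μ : EuclideanSpace ℝ (Fin n))
      : EuclideanSpace ℝ (Fin n)) = v := by
  have h1 : mfderiv (𝓡 n) (𝓡 n) e.symm (e q) (mfderiv (𝓡 n) (𝓡 n) e q v) = v :=
    congrArg (fun L => L v) ((mdifferentiable_of_mem_maximalAtlas he).symm_comp_deriv hq)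
  exact sum_smul_map_single (mfderiv (𝓡 n) (𝓡 n) e.symm (e q)) (mfderiv (𝓡 n) (𝓡 n) e q) v h1

end Charts

namespace LorentzianMetric

variable {M : Type*} [TopologicalSpace M] [ChartedSpace (EuclideanSpace ℝ (Fin 4)) M]
  [IsManifold (𝓡 4) ∞ M] (g : LorentzianMetric M)
  {e : OpenPartialHomeomorph M (EuclideanSpace ℝ (Fin 4))}

theorem comp_symm (y : EuclideanSpace ℝ (Fin 4)) (μ ν : Fin 4) :
    g.comp e y μ ν = g.comp e y ν μ :=
  g.symm _ _ _

/-- The metric at equal base points, its arguments being read in the model space: this avoids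
transporting tangent vectors along `e.symm (e q) = q`. -/
theorem val_congr {q q' : M} (h : q' = q) (v w : EuclideanSpace ℝ (Fin 4)) :
    (g.val q' : EuclideanSpace ℝ (Fin 4) →L[ℝ] EuclideanSpace ℝ (Fin 4) →L[ℝ] ℝ) v w
      = (g.val q : EuclideanSpace ℝ (Fin 4) →L[ℝ] EuclideanSpace ℝ (Fin 4) →L[ℝ] ℝ) v w := by
  subst h
  rfl

/-- The scalar product of tangent vectors in terms of their components. -/
theorem val_eq_ip (he : e ∈ IsManifold.maximalAtlas (𝓡 4) ∞ M) {q : M}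
    (hq : q ∈ e.source) (v w : TangentSpace (𝓡 4) q) :
    g.val q v w = ip (g.comp e) (e q) (vecComp e v) (vecComp e w) := by
  have h1 : ∀ μ ν, g.comp e (e q) μ ν
      = (g.val q : EuclideanSpace ℝ (Fin 4) →L[ℝ] EuclideanSpace ℝ (Fin 4) →L[ℝ] ℝ)
        (coordVec e (e q) μ) (coordVec e (e q) ν) := fun μ ν =>
    g.val_congr (e.left_inv hq) _ _
  have h2 := bilin_sum_smul (E := EuclideanSpace ℝ (Fin 4))
    (g.val q : EuclideanSpace ℝ (Fin 4) →L[ℝ] EuclideanSpace ℝ (Fin 4) →L[ℝ] ℝ)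
    (vecComp e v) (vecComp e w)
    (fun μ => (coordVec e (e q) μ : EuclideanSpace ℝ (Fin 4)))
  have hv := sum_vecComp_smul_coordVec he hq v
  have hw := sum_vecComp_smul_coordVec he hq w
  rw [ip_apply]
  simp only [h1]
  refine Eq.trans ?_ h2
  exact congrArg₂
    (fun a b => (g.val q : EuclideanSpace ℝ (Fin 4) →L[ℝ] EuclideanSpace ℝ (Fin 4) →L[ℝ] ℝ) a b)
    hv.symm hw.symm

theorem contMDiffOn_coordVec (he : e ∈ IsManifold.maximalAtlas (𝓡 4) ∞ M) (μ : Fin 4) :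
    ContMDiffOn (𝓡 4) (𝓡 4).tangent ∞
      (fun y => (⟨e.symm y, coordVec e y μ⟩ : TangentBundle (𝓡 4) M)) e.target := by
  have hs := contMDiffOn_symm_of_mem_maximalAtlas he
  have ht := hs.contMDiffOn_tangentMapWithin (m := ∞) (by simp) e.open_target.uniqueMDiffOn
  have hv : ContMDiff (𝓡 4) (𝓡 4).tangent ∞ (fun y => (⟨y, EuclideanSpace.single μ (1 : ℝ)⟩ :
      TangentBundle (𝓡 4) (EuclideanSpace ℝ (Fin 4)))) :=
    contMDiff_vectorSpace_iff_contDiff.mpr contDiff_const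
  refine (ht.comp hv.contMDiffOn fun y hy => hy).congr fun y hy => ?_
  simp only [Function.comp_apply, tangentMapWithin, mfderivWithin_of_isOpen e.open_target hy]
  rfl

theorem contDiffOn_comp (he : e ∈ IsManifold.maximalAtlas (𝓡 4) ∞ M) (μ ν : Fin 4) :
    ContDiffOn ℝ ∞ (fun y => g.comp e y μ ν) e.target := by
  rw [← contMDiffOn_iff_contDiffOn]
  intro y hy
  have hg := (g.contMDiff.comp_contMDiffOn (contMDiffOn_symm_of_mem_maximalAtlas he)) y hy
  have := ContMDiffWithinAt.clm_bundle_apply₂ (F₁ := EuclideanSpace ℝ (Fin 4))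
    (F₂ := EuclideanSpace ℝ (Fin 4)) (F₃ := ℝ) (E₃ := Bundle.Trivial M ℝ)
    (E₁ := fun x : M => TangentSpace (𝓡 4) x) (E₂ := fun x : M => TangentSpace (𝓡 4) x)
    (ψ := fun y => g.val (e.symm y)) hg
    (contMDiffOn_coordVec he μ y hy) (contMDiffOn_coordVec he ν y hy)
  rw [Bundle.contMDiffWithinAt_totalSpace] at this
  exact this.2

end LorentzianMetric

namespace SpatialHypersurface

variable {M : Type*} [TopologicalSpace M] [ChartedSpace (EuclideanSpace ℝ (Fin 4)) M]
  [IsManifold (𝓡 4) ∞ M] {g : LorentzianMetric M}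
  {S : Type*} [TopologicalSpace S] [ChartedSpace (EuclideanSpace ℝ (Fin 3)) S]
  [IsManifold (𝓡 3) ∞ S] (H : SpatialHypersurface g S)
  {e : OpenPartialHomeomorph M (EuclideanSpace ℝ (Fin 4))}
  {c : OpenPartialHomeomorph S (EuclideanSpace ℝ (Fin 3))}

/-- The coordinate domain of the hypersurface that is mapped into the domain of the chart `e`. -/
def coordDomain (H : SpatialHypersurface g S)
    (e : OpenPartialHomeomorph M (EuclideanSpace ℝ (Fin 4)))
    (c : OpenPartialHomeomorph S (EuclideanSpace ℝ (Fin 3))) : Set (EuclideanSpace ℝ (Fin 3)) :=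
  c.target ∩ c.symm ⁻¹' (H.toFun ⁻¹' e.source)

theorem isOpen_coordDomain : IsOpen (H.coordDomain e c) :=
  c.isOpen_inter_preimage_symm (e.open_source.preimage H.contMDiff_toFun.continuous)

theorem contDiffOn_coordMap (he : e ∈ IsManifold.maximalAtlas (𝓡 4) ∞ M)
    (hc : c ∈ IsManifold.maximalAtlas (𝓡 3) ∞ S) :
    ContDiffOn ℝ ∞ (H.coordMap e c) (H.coordDomain e c) := by
  rw [← contMDiffOn_iff_contDiffOn]
  have h1 : ContMDiffOn (𝓡 3) (𝓡 4) ∞ (H.toFun ∘ c.symm) (H.coordDomain e c) :=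
    H.contMDiff_toFun.comp_contMDiffOn
      ((contMDiffOn_symm_of_mem_maximalAtlas hc).mono Set.inter_subset_left)
  exact (contMDiffOn_of_mem_maximalAtlas he).comp h1 fun z hz => hz.2

theorem contDiffOn_normalComp (he : e ∈ IsManifold.maximalAtlas (𝓡 4) ∞ M)
    (hc : c ∈ IsManifold.maximalAtlas (𝓡 3) ∞ S) (μ : Fin 4) :
    ContDiffOn ℝ ∞ (H.normalComp e c μ) (H.coordDomain e c) := by
  rw [← contMDiffOn_iff_contDiffOn]
  have h1 : ContMDiffOn (𝓡 3) (𝓡 4).tangent ∞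
      (fun z => (⟨H.toFun (c.symm z), H.normal (c.symm z)⟩ : TangentBundle (𝓡 4) M))
      (H.coordDomain e c) :=
    H.contMDiff_normal.comp_contMDiffOn
      ((contMDiffOn_symm_of_mem_maximalAtlas hc).mono Set.inter_subset_left)
  have ht := (contMDiffOn_of_mem_maximalAtlas he).contMDiffOn_tangentMapWithin (m := ∞) (by simp)
    e.open_source.uniqueMDiffOn
  have h2 := ht.comp h1 fun z hz => hz.2
  have h3 := (contMDiff_snd_tangentBundle_modelSpace (n := ∞) (EuclideanSpace ℝ (Fin 4))
    (𝓡 4)).comp_contMDiffOn h2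
  have h4 := (EuclideanSpace.proj μ : EuclideanSpace ℝ (Fin 4) →L[ℝ] ℝ).contMDiff.comp_contMDiffOn
    (n := ∞) h3
  refine h4.congr fun z hz => ?_
  have hD : mfderivWithin (𝓡 4) (𝓡 4) e e.source (H.toFun (c.symm z))
      = mfderiv (𝓡 4) (𝓡 4) e (H.toFun (c.symm z)) :=
    mfderivWithin_of_isOpen e.open_source hz.2
  change vecComp e (H.normal (c.symm z)) μ = (EuclideanSpace.proj μ :
    EuclideanSpace ℝ (Fin 4) →L[ℝ] ℝ) (mfderivWithin (𝓡 4) (𝓡 4) e e.source (H.toFun (c.symm z))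
      (H.normal (c.symm z)))
  rw [hD]
  rfl

/-- The components of the pushed forward coordinate vectors are the partial derivatives of the
immersion in coordinates. -/
theorem vecComp_mfderiv_coordVec (he : e ∈ IsManifold.maximalAtlas (𝓡 4) ∞ M)
    (hc : c ∈ IsManifold.maximalAtlas (𝓡 3) ∞ S) {z : EuclideanSpace ℝ (Fin 3)}
    (hz : z ∈ H.coordDomain e c) (i : Fin 3) :
    vecComp e (mfderiv (𝓡 3) (𝓡 4) H.toFun (c.symm z) (coordVec c z i))
      = velocity (H.coordMap e c) i z := by
  have d1 := (mdifferentiable_of_mem_maximalAtlas hc).mdifferentiableAt_symm hz.1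
  have d2 : MDifferentiableAt (𝓡 3) (𝓡 4) H.toFun (c.symm z) :=
    (H.contMDiff_toFun _).mdifferentiableAt (by simp)
  have d3 := (mdifferentiable_of_mem_maximalAtlas he).mdifferentiableAt hz.2
  have d12 : MDifferentiableAt (𝓡 3) (𝓡 4) (H.toFun ∘ c.symm) z := d2.comp z d1
  have hD : mfderiv (𝓡 3) (𝓡 4) (H.coordMap e c) z
      = (mfderiv (𝓡 4) (𝓡 4) e (H.toFun (c.symm z))).comp
        ((mfderiv (𝓡 3) (𝓡 4) H.toFun (c.symm z)).comp (mfderiv (𝓡 3) (𝓡 3) c.symm z)) := by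
    have h1 : H.coordMap e c = e ∘ (H.toFun ∘ c.symm) := rfl
    rw [h1, mfderiv_comp z d3 d12, mfderiv_comp z d2 d1]
    rfl
  have hφ := differentiableAt_of_contDiffOn H.isOpen_coordDomain (H.contDiffOn_coordMap he hc) hz
  funext μ
  rw [velocity, pd_apply_eq_fderiv hφ, ← mfderiv_eq_fderiv, hD]
  rfl

theorem gamma_eq_ip (he : e ∈ IsManifold.maximalAtlas (𝓡 4) ∞ M)
    (hc : c ∈ IsManifold.maximalAtlas (𝓡 3) ∞ S) {z : EuclideanSpace ℝ (Fin 3)}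
    (hz : z ∈ H.coordDomain e c) (i j : Fin 3) :
    H.gamma c z i j = ip (g.comp e) (H.coordMap e c z) (velocity (H.coordMap e c) i z)
      (velocity (H.coordMap e c) j z) := by
  rw [← H.vecComp_mfderiv_coordVec he hc hz, ← H.vecComp_mfderiv_coordVec he hc hz]
  exact g.val_eq_ip he hz.2 _ _

/-- The induced metric is positive definite, hence nondegenerate. -/
theorem det_gamma_ne_zero (hc : c ∈ IsManifold.maximalAtlas (𝓡 3) ∞ S)
    {z : EuclideanSpace ℝ (Fin 3)} (hz : z ∈ c.target) : (H.gamma c z).det ≠ 0 := by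
  intro h0
  obtain ⟨v, hv, hγv⟩ := Matrix.exists_mulVec_eq_zero_iff.mpr h0
  set D : EuclideanSpace ℝ (Fin 3) →L[ℝ] EuclideanSpace ℝ (Fin 3) :=
    mfderiv (𝓡 3) (𝓡 3) c.symm z with hD
  set w : EuclideanSpace ℝ (Fin 3) := D (WithLp.toLp 2 v) with hw
  have hw0 : w ≠ 0 := by
    intro hw0
    have h1 : mfderiv (𝓡 3) (𝓡 3) c (c.symm z) (mfderiv (𝓡 3) (𝓡 3) c.symm z (WithLp.toLp 2 v))
        = (WithLp.toLp 2 v : EuclideanSpace ℝ (Fin 3)) :=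
      congrArg (fun L => L (WithLp.toLp 2 v))
        ((mdifferentiable_of_mem_maximalAtlas hc).comp_symm_deriv hz)
    have h2 : mfderiv (𝓡 3) (𝓡 3) c.symm z (WithLp.toLp 2 v) = 0 := hw0
    rw [h2, map_zero] at h1
    apply hv
    have h3 : WithLp.toLp 2 v = (0 : EuclideanSpace ℝ (Fin 3)) := h1.symm
    funext i
    exact congrArg (fun u : EuclideanSpace ℝ (Fin 3) => u i) h3
  have hpos := H.spacelike (c.symm z) w hw0
  set F : EuclideanSpace ℝ (Fin 3) →L[ℝ] EuclideanSpace ℝ (Fin 4) :=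
    mfderiv (𝓡 3) (𝓡 4) H.toFun (c.symm z) with hF
  set B : EuclideanSpace ℝ (Fin 4) →L[ℝ] EuclideanSpace ℝ (Fin 4) →L[ℝ] ℝ :=
    g.val (H.toFun (c.symm z)) with hB
  have hpos' : 0 < B (F w) (F w) := hpos
  have hγ : ∀ i j, H.gamma c z i j
      = B (F (D (EuclideanSpace.single i 1))) (F (D (EuclideanSpace.single j 1))) :=
    fun i j => rfl
  have hexp : B (F w) (F w) = v ⬝ᵥ (H.gamma c z *ᵥ v) := by
    have hFw : F w = ∑ i, v i • F (D (EuclideanSpace.single i 1)) := by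
      rw [hw, ← sum_smul_single (WithLp.toLp 2 v)]
      simp only [map_sum, map_smul]
    rw [hFw, bilin_sum_smul]
    simp only [Matrix.mulVec, dotProduct, hγ, Finset.mul_sum]
    exact Finset.sum_congr rfl fun _ _ => Finset.sum_congr rfl fun _ _ => by ring
  rw [hexp, hγv, dotProduct_zero] at hpos'
  exact lt_irrefl _ hpos'

/-- In coordinates a spatial hypersurface is a parametrized hypersurface of a domain on which the
metric components are nondegenerate. The domain is cut out of the chart by this condition, which
holds along the hypersurface because of the adapted frame `(∂_1, ∂_2, ∂_3, n)`. -/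
theorem isParamHypersurface (he : e ∈ IsManifold.maximalAtlas (𝓡 4) ∞ M)
    (hc : c ∈ IsManifold.maximalAtlas (𝓡 3) ∞ S) :
    IsParamHypersurface (g.comp e) (e.target ∩ {y | (g.comp e y).det ≠ 0}) (H.gamma c)
      (H.coordDomain e c) (H.coordMap e c) (fun z μ => H.normalComp e c μ z) := by
  have hunit : ∀ z ∈ H.coordDomain e c, ip (g.comp e) (H.coordMap e c z)
      (fun μ => H.normalComp e c μ z) (fun μ => H.normalComp e c μ z) = -1 := fun z hz =>
    (g.val_eq_ip he hz.2 _ _).symm.trans (H.normal_unit (c.symm z))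
  have horth : ∀ z ∈ H.coordDomain e c, ∀ i, ip (g.comp e) (H.coordMap e c z)
      (fun μ => H.normalComp e c μ z) (velocity (H.coordMap e c) i z) = 0 := fun z hz i => by
    rw [← H.vecComp_mfderiv_coordVec he hc hz]
    exact (g.val_eq_ip he hz.2 _ _).symm.trans (H.normal_orthogonal (c.symm z) _)
  have hframe : ∀ z ∈ H.coordDomain e c, IsAdaptedFrame (g.comp e (H.coordMap e c z))
      (H.gamma c z) (fun i => velocity (H.coordMap e c) i z) (fun μ => H.normalComp e c μ z) :=
    fun z hz =>
    { tangent := fun i j => (H.gamma_eq_ip he hc hz i j).symm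
      tangent_normal := fun i => (ip_symm_of_symm (g.comp_symm _) _ _).trans (horth z hz i)
      normal_tangent := horth z hz
      normal := hunit z hz
      det_ne_zero := H.det_gamma_ne_zero hc hz.1 }
  exact
  { metric :=
    { isOpen := (contDiffOn_det (g.contDiffOn_comp he)).continuousOn.isOpen_inter_preimage
        e.open_target isOpen_compl_singleton
      contDiffOn := fun i j => (g.contDiffOn_comp he i j).mono Set.inter_subset_left
      symm := fun _ i j => g.comp_symm _ i j
      det_ne_zero := fun hy => hy.2 }
    map :=
    { isOpen := H.isOpen_coordDomain
      contDiffOn := H.contDiffOn_coordMap he hc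
      mapsTo := fun z hz => ⟨e.map_source hz.2, (hframe z hz).det_metric_ne_zero⟩ }
    contDiffOn_normal := H.contDiffOn_normalComp he hc
    induced := fun hz i j => H.gamma_eq_ip he hc hz i j
    unit := fun hz => hunit _ hz
    orthogonal := fun hz i => horth _ hz i
    det_induced_ne_zero := fun hz => H.det_gamma_ne_zero hc hz.1 }

theorem extrinsic_eq_secondForm (z : EuclideanSpace ℝ (Fin 3)) :
    H.extrinsic e c z
      = secondForm (g.comp e) (H.coordMap e c) (fun z μ => H.normalComp e c μ z) z := by
  ext i j
  rw [secondForm, Matrix.of_apply, ip_apply]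
  rfl

end SpatialHypersurface

end ADM

end

theorem mainTheorem1
    {M : Type*} [TopologicalSpace M] [ChartedSpace (EuclideanSpace ℝ (Fin 4)) M]
    [IsManifold (𝓡 4) ∞ M]
    {S : Type*} [TopologicalSpace S] [ChartedSpace (EuclideanSpace ℝ (Fin 3)) S]
    [IsManifold (𝓡 3) ∞ S]
    (g : ADM.LorentzianMetric M) (Λ : ℝ) (hvac : g.IsVacuum Λ)
    (H : ADM.SpatialHypersurface g S)
    (e : OpenPartialHomeomorph M (EuclideanSpace ℝ (Fin 4)))
    (he : e ∈ IsManifold.maximalAtlas (𝓡 4) ∞ M)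
    (c : OpenPartialHomeomorph S (EuclideanSpace ℝ (Fin 3)))
    (hc : c ∈ IsManifold.maximalAtlas (𝓡 3) ∞ S)
    (x : EuclideanSpace ℝ (Fin 3)) (hx : x ∈ c.target)
    (hxe : H.toFun (c.symm x) ∈ e.source) :
    (∀ i j : Fin 3, H.electric e c i j x =
      - ADM.ricci (H.gamma c) i j x
        - H.meanCurvature e c x * H.extrinsic e c x i j
        + ∑ k, ∑ l, H.extrinsic e c x i k * (H.gamma c x)⁻¹ k l * H.extrinsic e c x l j
        + (2 / 3) * Λ * H.gamma c x i j) ∧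
    (H.CompatiblyOriented e c x → ∀ i j : Fin 3, H.magnetic e c i j x =
      ∑ l, ∑ s, ADM.epsilonMixed3 (H.gamma c) l s j x *
        ADM.covDeriv (H.gamma c) (H.extrinsic e c) s i l x) := by
  have P := H.isParamHypersurface he hc
  have hz : x ∈ H.coordDomain e c := ⟨hx, hxe⟩
  have hv := hvac e he (H.coordMap e c x) (e.map_source hxe)
  have hK : H.extrinsic e c
      = ADM.secondForm (g.comp e) (H.coordMap e c) (fun z μ => H.normalComp e c μ z) :=
    funext H.extrinsic_eq_secondForm
  refine ⟨fun i j => ?_, fun hpos i j => ?_⟩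
  · rw [ADM.SpatialHypersurface.meanCurvature, hK]
    exact P.electric_eq hz hv i j
  · rw [hK]
    exact P.magnetic_eq hz hv hpos i j
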